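/- Let $\mathbb{C}_+=\{z\in\mathbb{C}:\operatorname{Re}z>0\}$, let $dA$ be Lebesgue measure on $\mathbb{C}_+$, and let $A^2_1(\mathbb{C}_+)$ be the space of holomorphic functions $f$ on $\mathbb{C}_+$ with $\int_{\mathbb{C}_+}|f(z)|^2\operatorname{Re}z\,dA(z)<\infty$, with norm given by $$\|f\|_{A^2_1(\mathbb{C}_+)}^2=2\pi^{1/2}\int_{\mathbb{C}_+}|f(z)|^2\operatorname{Re}z\,dA(z).$$ Fix $t>0$, and endow the space $ze^{-z/t}A^2_1(\mathbb{C}_+)=\{z\mapsto ze^{-z/t}f(z): f\in A^2_1(\mathbb{C}_+)\}$ with the norm $$\|F\|_{\mathcal{G}_2^t}=\pi^{-3/4}\,\bigl\|z^{-1}e^{z/t}F\bigr\|_{A^2_1(\mathbb{C}_+)}.$$ For every $g\in L^2_{\mathbb{C}}((0,t),\tau^2d\tau/t^2)$ and $z\in\mathbb{C}_+$ the integral $$\mathcal{L}_tg(z)=\frac1{t^2}\int_0^t\frac{z}{(t-\tau)^2}\exp\Bigl(-\frac{z}{t-\tau}\Bigr)g(\tau)\,\tau^2\,d\tau$$ converges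 absolutely, and $\mathcal{L}_t$ is an isometric (linear) isomorphism of $L^2_{\mathbb{C}}((0,t),\tau^2d\tau/t^2)$ onto $\bigl(ze^{-z/t}A^2_1(\mathbb{C}_+),\|\cdot\|_{\mathcal{G}_2^t}\bigr)$. Moreover, let $$d\mu^t(z)=2\pi^{-1}|z|^{-2}e^{\frac2t\operatorname{Re}z}\operatorname{Re}z\,dA(z),\qquad z\in\mathbb{C}_+.$$ For every $F\in ze^{-z/t}A^2_1(\mathbb{C}_+)$ and every compact exhaustion $\{E_N\}$ of $\mathbb{C}_+$ (compact sets with $E_N\subset\operatorname{int}E_{N+1}$ and $\bigcup_NE_N=\mathbb{C}_+$), the integrals below converge absolutely for all $N$ and all $\tau\in(0,t)$, they define functions of $\tau$ in $L^2((0,t),\tau^2d\tau/t^2)$, and $$(\mathcal{L}_t)^{-1}F(\tau)=\lim_{N\to\infty}\frac1{(t-\tau)^2}\int_{E_N}\overline{z}\,F(z)\exp\Bigl(-\frac{\overline z}{t-\tau}\Bigr)d\mu^t(z),$$ where the limit is taken in the norm of $L^2((0,t),\tau^2d\tau/t^2)$. -/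

import Mathlib

open MeasureTheory Filter Topology
open scoped ComplexConjugate ENNReal

noncomputable section

/-- The open right half plane `ℂ₊ = {z : Re z > 0}`. As a subtype of `ℂ` it carries the
subspace topology and the Borel σ-algebra. -/
abbrev RightHalfPlane : Type := {z : ℂ // 0 < z.re}

/-- The area measure `dA` on `ℂ₊`: the Lebesgue measure of `ℂ` on subsets of `ℂ₊`. -/
def areaMeasure : Measure RightHalfPlane := Measure.comap Subtype.val (volume : Measure ℂ)

/-- `f : ℂ₊ → ℂ` is holomorphic: it is the restriction to `ℂ₊` of a function that is complex
differentiable at every point of the open set `ℂ₊`. -/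
def IsHolomorphic (f : RightHalfPlane → ℂ) : Prop :=
  ∃ F : ℂ → ℂ, DifferentiableOn ℂ F {z : ℂ | 0 < z.re} ∧ ∀ z : RightHalfPlane, f z = F z

theorem IsHolomorphic.continuous {f : RightHalfPlane → ℂ} (hf : IsHolomorphic f) :
    Continuous f := by
  obtain ⟨F, hF, h⟩ := hf
  have h2 : f = fun z : RightHalfPlane => F z := funext h
  rw [h2]
  exact hF.continuousOn.comp_continuous continuous_subtype_val (fun z => z.2)

/-- The weighted Bergman space `A²₁(ℂ₊)`: the holomorphic `f` on `ℂ₊` with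
`∫ |f(z)|² Re z dA(z) < ∞`. -/
def weightedBergman : Submodule ℂ (RightHalfPlane → ℂ) where
  carrier := {f | IsHolomorphic f ∧
    Integrable (fun z : RightHalfPlane => ‖f z‖ ^ 2 * (z : ℂ).re) areaMeasure}
  zero_mem' := ⟨⟨0, differentiableOn_const 0, fun _ => rfl⟩, by simp⟩
  add_mem' := by
    rintro f g ⟨hf, hfi⟩ ⟨hg, hgi⟩
    have hc : Continuous (f + g) := hf.continuous.add hg.continuous
    refine ⟨?_, ?_⟩
    · obtain ⟨F, hF, hfF⟩ := hf
      obtain ⟨G, hG, hgG⟩ := hg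
      exact ⟨F + G, hF.add hG, fun z => by simp [hfF z, hgG z]⟩
    · refine ((hfi.add hgi).const_mul 2).mono' ?_ (ae_of_all _ fun z => ?_)
      · exact ((hc.norm.pow 2).mul
          (Complex.continuous_re.comp continuous_subtype_val)).aestronglyMeasurable
      · have hz : 0 < (z : ℂ).re := z.2
        rw [Real.norm_of_nonneg (by positivity)]
        have h1 : ‖f z + g z‖ ≤ ‖f z‖ + ‖g z‖ := norm_add_le _ _
        have h2 : ‖f z + g z‖ ^ 2 ≤ 2 * (‖f z‖ ^ 2 + ‖g z‖ ^ 2) := by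
          nlinarith [norm_nonneg (f z + g z), sq_nonneg (‖f z‖ - ‖g z‖)]
        calc ‖(f + g) z‖ ^ 2 * (z : ℂ).re
            ≤ (2 * (‖f z‖ ^ 2 + ‖g z‖ ^ 2)) * (z : ℂ).re :=
              mul_le_mul_of_nonneg_right h2 hz.le
          _ = 2 * (‖f z‖ ^ 2 * (z : ℂ).re + ‖g z‖ ^ 2 * (z : ℂ).re) := by ring
  smul_mem' := by
    rintro c f ⟨⟨F, hF, hfF⟩, hfi⟩
    refine ⟨⟨c • F, hF.const_smul c, fun z => by simp [hfF z]⟩, ?_⟩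
    convert hfi.const_mul (‖c‖ ^ 2) using 2 with z
    simp only [Pi.smul_apply, smul_eq_mul, norm_mul]
    ring

/-- The norm of `A²₁(ℂ₊)`: `‖f‖² = 2 π^{1/2} ∫ |f(z)|² Re z dA(z)`. -/
def bergmanNorm (f : RightHalfPlane → ℂ) : ℝ :=
  Real.sqrt (2 * Real.sqrt Real.pi * ∫ z : RightHalfPlane, ‖f z‖ ^ 2 * (z : ℂ).re ∂areaMeasure)

/-- The space `z e^{-z/t} A²₁(ℂ₊)`: the functions `z ↦ z e^{-z/t} f(z)` with `f ∈ A²₁(ℂ₊)`. -/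
def rangeSpace (t : ℝ) : Submodule ℂ (RightHalfPlane → ℂ) :=
  weightedBergman.map (LinearMap.mulLeft ℂ
    (fun z : RightHalfPlane => (z : ℂ) * Complex.exp (-(z : ℂ) / t)))

/-- The norm of `z e^{-z/t} A²₁(ℂ₊)`: `π^{-3/4}` times the `A²₁(ℂ₊)`-norm of
`z⁻¹ e^{z/t} F(z)`. -/
def rangeNorm (t : ℝ) (F : RightHalfPlane → ℂ) : ℝ :=
  Real.pi ^ (-(3 / 4) : ℝ) *
    bergmanNorm (fun z => (z : ℂ)⁻¹ * Complex.exp ((z : ℂ) / t) * F z)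

/-- The measure `τ² dτ / t²` on the interval `(0, t)`. -/
def sourceMeasure (t : ℝ) : Measure ℝ :=
  (volume.restrict (Set.Ioo 0 t)).withDensity (fun τ => ENNReal.ofReal (τ ^ 2 / t ^ 2))

/-- The integrand `z (t-τ)⁻² e^{-z/(t-τ)} g(τ) τ²` of `L_t g(z)`. -/
def transformIntegrand (t : ℝ) (g : ℝ → ℂ) (z : RightHalfPlane) (τ : ℝ) : ℂ :=
  (z : ℂ) / ((t : ℂ) - τ) ^ 2 * Complex.exp (-((z : ℂ) / ((t : ℂ) - τ))) * g τ * (τ : ℂ) ^ 2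

/-- `L_t g(z) = t⁻² ∫₀ᵗ z (t-τ)⁻² e^{-z/(t-τ)} g(τ) τ² dτ`. -/
def transform (t : ℝ) (g : ℝ → ℂ) (z : RightHalfPlane) : ℂ :=
  1 / (t : ℂ) ^ 2 * ∫ τ in Set.Ioo 0 t, transformIntegrand t g z τ

/-- The measure `dμᵗ(z) = 2 π⁻¹ |z|⁻² e^{(2/t) Re z} Re z dA(z)` on `ℂ₊`. -/
def inversionMeasure (t : ℝ) : Measure RightHalfPlane :=
  areaMeasure.withDensity (fun z => ENNReal.ofReal
    (2 * Real.pi⁻¹ * (‖(z : ℂ)‖ ^ 2)⁻¹ * Real.exp (2 / t * (z : ℂ).re) * (z : ℂ).re))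

/-- The integrand `z̄ F(z) e^{-z̄/(t-τ)}` of the inversion formula. -/
def inversionIntegrand (t : ℝ) (F : RightHalfPlane → ℂ) (τ : ℝ) (z : RightHalfPlane) : ℂ :=
  conj (z : ℂ) * F z * Complex.exp (-(conj (z : ℂ) / ((t : ℂ) - τ)))

/-- The truncated inversion integral
`(t-τ)⁻² ∫_E z̄ F(z) e^{-z̄/(t-τ)} dμᵗ(z)`, as a function of `τ`. -/
def truncatedInverse (t : ℝ) (F : RightHalfPlane → ℂ) (E : Set RightHalfPlane) (τ : ℝ) : ℂ :=
  1 / ((t : ℂ) - τ) ^ 2 * ∫ z in E, inversionIntegrand t F τ z ∂(inversionMeasure t)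

end

noncomputable section

/-! The argument is one of reproducing kernels. Up to the measure, `transform` at `z` is the inner
product with a vector `atom t z`. The Gram matrix of these vectors is explicit (`inner_atom_atom`):
the substitution s = 1/(t-τ) turns it into an elementary Laplace integral with value `rangeKernel t
z w`.

The range space consists exactly of the holomorphic functions in L²(μᵗ), with equality of norms
(`mem_rangeSpace_iff`, `rangeNorm_eq`), and `rangeKernel` is its reproducing kernel
(`integral_mul_conj_rangeKernel`): a Cayley transform centred at w reduces this to the mean value
property on the disk with weight 1 - |ζ|². So the transform sends atoms to reproducing kernels with
the same Gram matrix and is isometric on their span. The span is dense by Fourier uniqueness on the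
line Re z = 1 (`dense_span_atom`).

Locally uniform convergence and Fatou's lemma extend the transform to a bounded operator T into
L²(μᵗ). Testing on atoms gives T*T = 1, and T(T*F) = F for F in the range space, so the inverse is
T*. The inversion formula is the continuity of T* applied to F·1_{E_N} → F, with T*(F·1_{E_N})
computed by Fubini. -/

/-! ### Weighted mean value property on the disk -/

theorem integrable_comp_polarCoord_symm {f : ℂ → ℂ} (hf : StronglyMeasurable f)
    (hi : Integrable f) :
    IntegrableOn (fun p : ℝ × ℝ => p.1 • f (Complex.polarCoord.symm p)) polarCoord.target := by
  have hm : Measurable fun p : ℝ × ℝ => f (Complex.polarCoord.symm p) := by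
    refine hf.measurable.comp ?_
    have : (fun p : ℝ × ℝ => Complex.polarCoord.symm p) =
        fun p => (p.1 : ℂ) * (Real.cos p.2 + Real.sin p.2 * Complex.I) :=
      funext fun p => Complex.polarCoord_symm_apply p
    have h2 : Measurable fun p : ℝ × ℝ =>
        (p.1 : ℂ) * (Real.cos p.2 + Real.sin p.2 * Complex.I) := by fun_prop
    rwa [← this] at h2
  refine ⟨(measurable_fst.smul hm).aestronglyMeasurable, ?_⟩
  have h2 := Complex.lintegral_comp_polarCoord_symm (fun z => ‖f z‖ₑ)
  have h3 : ∫⁻ z, ‖f z‖ₑ < ∞ := hi.2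
  rw [← h2] at h3
  refine lt_of_le_of_lt (le_of_eq ?_) h3
  refine setLIntegral_congr_fun polarCoord.open_target.measurableSet fun p hp => ?_
  have hp1 : 0 < p.1 := hp.1
  simp only [enorm_smul, smul_eq_mul]
  rw [Real.enorm_eq_ofReal hp1.le]

theorem integral_Ioo_circleMap {G : ℂ → ℂ} {r : ℝ} (h0 : 0 < r) (h1 : r < 1)
    (hG : DifferentiableOn ℂ G (Metric.ball 0 1)) :
    ∫ θ in Set.Ioo (-Real.pi) Real.pi, G (Complex.polarCoord.symm (r, θ)) = 2 * Real.pi * G 0 := by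
  have hd : DiffContOnCl ℂ G (Metric.ball 0 |r|) := by
    apply DifferentiableOn.diffContOnCl
    refine hG.mono ?_
    rw [closure_ball _ (abs_ne_zero.2 h0.ne'), abs_of_pos h0]
    exact Metric.closedBall_subset_ball h1
  have h2 := hd.circleAverage
  have h3 : ∀ θ : ℝ, G (Complex.polarCoord.symm (r, θ)) = G (circleMap 0 r θ) := by
    intro θ
    rw [Complex.polarCoord_symm_apply]
    simp [circleMap, Complex.exp_mul_I]
  simp_rw [h3]
  rw [← integral_Ioc_eq_integral_Ioo, ← intervalIntegral.integral_of_le (by linarith [Real.pi_pos])]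
  -- Polar coordinates use the angles (-π, π), the circle average uses [0, 2π]; periodicity
  -- identifies the two.
  have hper : Function.Periodic (fun θ => G (circleMap 0 r θ)) (2 * Real.pi) :=
    fun θ => by simp only [periodic_circleMap 0 r θ]
  have h4 := hper.intervalIntegral_add_eq (-Real.pi) 0
  rw [show -Real.pi + 2 * Real.pi = Real.pi by ring, zero_add] at h4
  rw [h4]
  rw [Real.circleAverage] at h2
  rw [← h2, Complex.real_smul]
  have : (Real.pi : ℂ) ≠ 0 := by exact_mod_cast Real.pi_ne_zero
  push_cast
  field_simp

/-- The mean value property on the unit disk with respect to the weight `1 - |ζ|²`. -/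
theorem integral_ball_one_sub_normSq_mul {G : ℂ → ℂ}
    (hG : DifferentiableOn ℂ G (Metric.ball 0 1))
    (hi : IntegrableOn (fun ζ : ℂ => ((1 - ‖ζ‖ ^ 2 : ℝ) : ℂ) * G ζ) (Metric.ball 0 1)) :
    ∫ ζ in Metric.ball (0 : ℂ) 1, ((1 - ‖ζ‖ ^ 2 : ℝ) : ℂ) * G ζ = Real.pi / 2 * G 0 := by
  -- Extension by zero, since the polar coordinate formula integrates over the whole plane.
  set h : ℂ → ℂ := (Metric.ball (0 : ℂ) 1).indicator
    (fun ζ : ℂ => ((1 - ‖ζ‖ ^ 2 : ℝ) : ℂ) * G ζ) with hh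
  have hc : ContinuousOn (fun ζ : ℂ => ((1 - ‖ζ‖ ^ 2 : ℝ) : ℂ) * G ζ) (Metric.ball 0 1) :=
    ContinuousOn.mul (by fun_prop) hG.continuousOn
  have hm : StronglyMeasurable h := by
    classical
    rw [hh, ← Set.piecewise_eq_indicator]
    exact (hc.measurable_piecewise continuousOn_const measurableSet_ball).stronglyMeasurable
  have hint : Integrable h := hi.integrable_indicator measurableSet_ball
  have hpol := integrable_comp_polarCoord_symm hm hint
  rw [← integral_indicator measurableSet_ball, ← hh, ← Complex.integral_comp_polarCoord_symm]
  rw [polarCoord_target] at hpol ⊢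
  rw [Measure.volume_eq_prod] at hpol ⊢
  rw [setIntegral_prod _ hpol]
  have hval : ∀ r ∈ Set.Ioi (0 : ℝ),
      ∫ θ in Set.Ioo (-Real.pi) Real.pi, r • h (Complex.polarCoord.symm (r, θ)) =
        (Set.Ioo (0 : ℝ) 1).indicator
          (fun r => ((r * (1 - r ^ 2) : ℝ) : ℂ) * (2 * Real.pi * G 0)) r := by
    intro r hr
    have hn : ∀ θ, ‖Complex.polarCoord.symm (r, θ)‖ = r := fun θ => by
      rw [Complex.norm_polarCoord_symm, abs_of_pos hr]
    by_cases h1 : r < 1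
    · rw [Set.indicator_of_mem (Set.mem_Ioo.2 ⟨hr, h1⟩), ← integral_Ioo_circleMap hr h1 hG,
        ← integral_const_mul]
      congr 1 with θ
      rw [hh, Set.indicator_of_mem (by rw [mem_ball_zero_iff, hn]; exact h1), hn, Complex.real_smul]
      push_cast
      ring
    · rw [Set.indicator_of_notMem (fun h => h1 h.2)]
      have : ∀ θ, h (Complex.polarCoord.symm (r, θ)) = 0 := fun θ =>
        Set.indicator_of_notMem (by rw [mem_ball_zero_iff, hn]; exact h1) _
      simp_rw [this, smul_zero, integral_zero]
  rw [setIntegral_congr_fun measurableSet_Ioi hval, setIntegral_indicator measurableSet_Ioo,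
    Set.inter_eq_right.2 (fun x hx => hx.1), integral_mul_const, integral_complex_ofReal,
    ← integral_Ioc_eq_integral_Ioo, ← intervalIntegral.integral_of_le zero_le_one]
  have : ∫ x in (0 : ℝ)..1, x * (1 - x ^ 2) = 1 / 4 := by
    have : ∀ x : ℝ, x * (1 - x ^ 2) = x - x ^ 3 := fun x => by ring
    simp_rw [this]
    rw [intervalIntegral.integral_sub (Continuous.intervalIntegrable (by fun_prop) _ _)
      (Continuous.intervalIntegrable (by fun_prop) _ _)]
    norm_num
  rw [this]
  push_cast
  ring

/-! ### Cayley transform and the reproducing formula on the half plane -/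

theorem Complex.det_restrictScalars_toSpanSingleton (c : ℂ) :
    ((ContinuousLinearMap.toSpanSingleton ℂ c).restrictScalars ℝ).det = ‖c‖ ^ 2 := by
  have h : (((ContinuousLinearMap.toSpanSingleton ℂ c).restrictScalars ℝ : ℂ →L[ℝ] ℂ) :
      ℂ →ₗ[ℝ] ℂ) = LinearMap.mulLeft ℝ c := by
    ext
    simp [mul_comm]
  rw [ContinuousLinearMap.det, h, ← Complex.normSq_eq_norm_sq, ← Algebra.norm_complex_apply,
    Algebra.norm_apply]
  rfl

/-- The Cayley transform from the unit disk onto the right half plane that maps `0` to `w`. -/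
def cayley (w ζ : ℂ) : ℂ := (w + conj w * ζ) / (1 - ζ)

theorem one_sub_ne_zero_of_mem_ball {ζ : ℂ} (hζ : ζ ∈ Metric.ball (0 : ℂ) 1) : 1 - ζ ≠ 0 := by
  intro h
  rw [← sub_eq_zero.1 h] at hζ
  simp at hζ

theorem cayley_add_conj (w : ℂ) {ζ : ℂ} (h : 1 - ζ ≠ 0) :
    cayley w ζ + conj w = 2 * w.re / (1 - ζ) := by
  have h2 : (2 * w.re : ℂ) = w + conj w := by rw [Complex.add_conj]; push_cast; ring
  rw [cayley, h2]
  field_simp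
  ring

theorem cayley_re (w : ℂ) {ζ : ℂ} (h : 1 - ζ ≠ 0) :
    (cayley w ζ).re = w.re * (1 - ‖ζ‖ ^ 2) / ‖1 - ζ‖ ^ 2 := by
  have h3 : ‖1 - ζ‖ ^ 2 ≠ 0 := by positivity
  rw [cayley, Complex.div_re, ← Complex.normSq_eq_norm_sq] at *
  rw [← Complex.normSq_eq_norm_sq]
  field_simp
  simp [Complex.normSq_apply]
  ring

theorem hasDerivAt_cayley (w : ℂ) {ζ : ℂ} (h : 1 - ζ ≠ 0) :
    HasDerivAt (cayley w) (2 * w.re / (1 - ζ) ^ 2) ζ := by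
  have h2 : (2 * w.re : ℂ) = w + conj w := by rw [Complex.add_conj]; push_cast; ring
  have h3 := (((hasDerivAt_id ζ).const_mul (conj w)).const_add w).div
    ((hasDerivAt_id ζ).const_sub 1) h
  refine h3.congr_deriv ?_
  rw [h2]
  simp only [id]
  congr 1
  ring

theorem cayley_injOn {w : ℂ} (hw : 0 < w.re) : Set.InjOn (cayley w) (Metric.ball 0 1) := by
  intro x hx y hy hxy
  have hx' := one_sub_ne_zero_of_mem_ball hx
  have hy' := one_sub_ne_zero_of_mem_ball hy
  have h1 := cayley_add_conj w hx'
  rw [hxy, cayley_add_conj w hy', div_eq_div_iff hy' hx'] at h1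
  have hw' : (2 * w.re : ℂ) ≠ 0 := by exact_mod_cast (by positivity : 2 * w.re ≠ 0)
  have := mul_left_cancel₀ hw' h1
  linear_combination -this

theorem norm_sub_lt_norm_add_conj {z w : ℂ} (hz : 0 < z.re) (hw : 0 < w.re) :
    ‖z - w‖ < ‖z + conj w‖ := by
  rw [← sq_lt_sq₀ (norm_nonneg _) (norm_nonneg _), ← Complex.normSq_eq_norm_sq,
    ← Complex.normSq_eq_norm_sq, Complex.normSq_apply, Complex.normSq_apply]
  simp
  nlinarith [mul_pos hz hw]

theorem cayley_image {w : ℂ} (hw : 0 < w.re) :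
    cayley w '' Metric.ball 0 1 = {z : ℂ | 0 < z.re} := by
  ext z
  constructor
  · rintro ⟨ζ, hζ, rfl⟩
    have h1 := one_sub_ne_zero_of_mem_ball hζ
    rw [Set.mem_ofPred_eq, cayley_re w h1]
    have h2 : ‖ζ‖ < 1 := by simpa using hζ
    have : 0 < 1 - ‖ζ‖ ^ 2 := by nlinarith [norm_nonneg ζ]
    positivity
  · intro hz
    have hlt := norm_sub_lt_norm_add_conj hz hw
    have hpos : 0 < ‖z + conj w‖ := (norm_nonneg _).trans_lt hlt
    have hne : z + conj w ≠ 0 := norm_pos_iff.1 hpos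
    refine ⟨(z - w) / (z + conj w), ?_, ?_⟩
    · rw [mem_ball_zero_iff, norm_div, div_lt_one hpos]
      exact hlt
    · have hw' : w + conj w ≠ 0 := by
        rw [Complex.add_conj]
        exact_mod_cast (by positivity : 2 * w.re ≠ 0)
      have h1 : 1 - (z - w) / (z + conj w) = (w + conj w) / (z + conj w) := by
        field_simp
        ring
      rw [cayley, h1]
      field_simp
      ring

theorem hasFDerivWithinAt_cayley (w : ℂ) {ζ : ℂ} (hζ : ζ ∈ Metric.ball (0 : ℂ) 1) :
    HasFDerivWithinAt (cayley w)
      ((ContinuousLinearMap.toSpanSingleton ℂ (2 * w.re / (1 - ζ) ^ 2)).restrictScalars ℝ)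
      (Metric.ball 0 1) ζ :=
  ((hasDerivAt_cayley w (one_sub_ne_zero_of_mem_ball hζ)).hasFDerivAt.restrictScalars
    ℝ).hasFDerivWithinAt

theorem integrableOn_halfPlane_iff {w : ℂ} (hw : 0 < w.re) (f : ℂ → ℂ) :
    IntegrableOn f {z : ℂ | 0 < z.re} ↔
      IntegrableOn (fun ζ : ℂ => ‖2 * w.re / (1 - ζ) ^ 2‖ ^ 2 • f (cayley w ζ))
        (Metric.ball 0 1) := by
  rw [← cayley_image hw, integrableOn_image_iff_integrableOn_abs_det_fderiv_smul volume
    measurableSet_ball (fun ζ hζ => hasFDerivWithinAt_cayley w hζ) (cayley_injOn hw)]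
  simp_rw [Complex.det_restrictScalars_toSpanSingleton, abs_of_nonneg (sq_nonneg ‖_‖)]

theorem integral_halfPlane_eq {w : ℂ} (hw : 0 < w.re) (f : ℂ → ℂ) :
    ∫ z in {z : ℂ | 0 < z.re}, f z =
      ∫ ζ in Metric.ball (0 : ℂ) 1, ‖2 * w.re / (1 - ζ) ^ 2‖ ^ 2 • f (cayley w ζ) := by
  rw [← cayley_image hw, integral_image_eq_integral_abs_det_fderiv_smul volume
    measurableSet_ball (fun ζ hζ => hasFDerivWithinAt_cayley w hζ) (cayley_injOn hw)]
  simp_rw [Complex.det_restrictScalars_toSpanSingleton, abs_of_nonneg (sq_nonneg ‖_‖)]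

/-- The Jacobian contributes |1-ζ|⁻⁴, the weight |1-ζ|⁻² and the conjugated kernel (1-ζ̄)³. The
antiholomorphic factors cancel, so a holomorphic c leaves a holomorphic function against 1 - |ζ|².
The powers of Re w cancel too, with constant 4/8. -/
theorem cayley_weighted_kernel {w ζ : ℂ} (hw : 0 < w.re) (h : 1 - ζ ≠ 0) (c : ℂ) :
    ‖2 * w.re / (1 - ζ) ^ 2‖ ^ 2 •
      (c * conj (1 / (cayley w ζ + conj w) ^ 3) * ((cayley w ζ).re : ℂ)) =
      1 / 2 * (((1 - ‖ζ‖ ^ 2 : ℝ) : ℂ) * (c / (1 - ζ) ^ 3)) := by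
  have hw' : (w.re : ℂ) ≠ 0 := by exact_mod_cast hw.ne'
  have hc : 1 - conj ζ ≠ 0 := by
    intro h2
    apply h
    have := congrArg conj h2
    simpa using this
  have hn : ((‖1 - ζ‖ : ℂ)) ^ 2 = (1 - ζ) * (1 - conj ζ) := by
    rw [← Complex.mul_conj']
    simp
  rw [cayley_add_conj w h, cayley_re w h, Complex.real_smul]
  simp only [norm_div, norm_mul, norm_pow, Complex.norm_real, Real.norm_of_nonneg hw.le]
  push_cast
  simp only [div_pow, mul_pow, map_div₀, map_one, map_mul, map_pow, map_sub, Complex.conj_ofReal,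
    map_ofNat, Complex.norm_ofNat]
  rw [show ((‖1 - ζ‖ : ℂ) ^ 2) ^ 2 = ((1 - ζ) * (1 - conj ζ)) ^ 2 by rw [hn], hn]
  field_simp
  push_cast
  ring

/-- The reproducing formula of the weighted Bergman space of the right half plane. -/
theorem integral_halfPlane_mul_kernel {F : ℂ → ℂ} {w : ℂ} (hw : 0 < w.re)
    (hF : DifferentiableOn ℂ F {z : ℂ | 0 < z.re})
    (hi : IntegrableOn (fun z => F z * conj (1 / (z + conj w) ^ 3) * (z.re : ℂ))
      {z : ℂ | 0 < z.re}) :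
    ∫ z in {z : ℂ | 0 < z.re}, F z * conj (1 / (z + conj w) ^ 3) * (z.re : ℂ) =
      Real.pi / 4 * F w := by
  have hcongr : Set.EqOn (fun ζ : ℂ => ‖2 * w.re / (1 - ζ) ^ 2‖ ^ 2 •
      (F (cayley w ζ) * conj (1 / (cayley w ζ + conj w) ^ 3) * ((cayley w ζ).re : ℂ)))
      (fun ζ : ℂ => 1 / 2 * (((1 - ‖ζ‖ ^ 2 : ℝ) : ℂ) * (F (cayley w ζ) / (1 - ζ) ^ 3)))
      (Metric.ball 0 1) :=
    fun ζ hζ => cayley_weighted_kernel hw (one_sub_ne_zero_of_mem_ball hζ) _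
  rw [integrableOn_halfPlane_iff hw, integrableOn_congr_fun hcongr measurableSet_ball] at hi
  rw [integral_halfPlane_eq hw, setIntegral_congr_fun measurableSet_ball hcongr,
    integral_const_mul, integral_ball_one_sub_normSq_mul]
  -- The point ζ = 0 corresponds to w, and the constant is 1/2 · π/2.
  · simp [cayley]
    ring
  · intro ζ hζ
    have h1 := one_sub_ne_zero_of_mem_ball hζ
    have hz : 0 < (cayley w ζ).re := by
      have : cayley w ζ ∈ {z : ℂ | 0 < z.re} := cayley_image hw ▸ Set.mem_image_of_mem _ hζ
      exact this
    have h2 : DifferentiableAt ℂ F (cayley w ζ) :=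
      (hF _ hz).differentiableAt ((isOpen_lt continuous_const Complex.continuous_re).mem_nhds hz)
    have h3 := h2.comp ζ (hasDerivAt_cayley w h1).differentiableAt
    have h4 : DifferentiableAt ℂ (fun ζ : ℂ => (1 - ζ) ^ 3) ζ := by fun_prop
    exact (h3.div h4 (pow_ne_zero 3 h1)).differentiableWithinAt
  · have := hi.const_mul 2
    simpa [IntegrableOn] using this

/-- On the disk the squared kernel becomes a constant times 1 - |ζ|²: the cube in its holomorphic
factor cancels the remaining (1-ζ)⁻³. -/
theorem integrableOn_normSq_kernel {w : ℂ} (hw : 0 < w.re) :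
    IntegrableOn (fun z : ℂ => ‖1 / (z + conj w) ^ 3‖ ^ 2 * z.re) {z : ℂ | 0 < z.re} := by
  have key : IntegrableOn (fun z : ℂ => (1 / (z + conj w) ^ 3) * conj (1 / (z + conj w) ^ 3) *
      (z.re : ℂ)) {z : ℂ | 0 < z.re} := by
    rw [integrableOn_halfPlane_iff hw]
    have hcongr : Set.EqOn (fun ζ : ℂ => ‖2 * w.re / (1 - ζ) ^ 2‖ ^ 2 •
        ((1 / (cayley w ζ + conj w) ^ 3) * conj (1 / (cayley w ζ + conj w) ^ 3) *
          ((cayley w ζ).re : ℂ)))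
        (fun ζ : ℂ => 1 / 2 * (((1 - ‖ζ‖ ^ 2 : ℝ) : ℂ) * (1 / (2 * w.re) ^ 3)))
        (Metric.ball 0 1) := by
      intro ζ hζ
      have h1 := one_sub_ne_zero_of_mem_ball hζ
      have hw' : (w.re : ℂ) ≠ 0 := by exact_mod_cast hw.ne'
      simp only
      rw [cayley_weighted_kernel hw h1, cayley_add_conj w h1]
      field_simp
    rw [integrableOn_congr_fun hcongr measurableSet_ball]
    refine IntegrableOn.mono_set (t := Metric.closedBall 0 1) ?_ Metric.ball_subset_closedBall
    exact ContinuousOn.integrableOn_compact (isCompact_closedBall _ _) (by fun_prop)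
  refine IntegrableOn.congr_fun key.norm (fun z hz => ?_)
    (isOpen_lt continuous_const Complex.continuous_re).measurableSet
  have hz' : 0 < z.re := hz
  simp only [norm_mul, RCLike.norm_conj, Complex.norm_real, Real.norm_of_nonneg hz'.le]
  ring

/-! ### The range space as a Bergman space of μᵗ -/

theorem isOpen_halfPlane : IsOpen {z : ℂ | 0 < z.re} :=
  isOpen_lt continuous_const Complex.continuous_re

theorem measurableEmbedding_halfPlane_val :
    MeasurableEmbedding (Subtype.val : RightHalfPlane → ℂ) :=
  MeasurableEmbedding.subtype_coe isOpen_halfPlane.measurableSet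

theorem map_val_areaMeasure :
    areaMeasure.map Subtype.val = (volume : Measure ℂ).restrict {z : ℂ | 0 < z.re} :=
  map_comap_subtype_coe isOpen_halfPlane.measurableSet _

theorem integrable_areaMeasure_iff {E : Type*} [NormedAddCommGroup E] (f : ℂ → E) :
    Integrable (fun z : RightHalfPlane => f z) areaMeasure ↔
      IntegrableOn f {z : ℂ | 0 < z.re} := by
  rw [IntegrableOn, ← map_val_areaMeasure, measurableEmbedding_halfPlane_val.integrable_map_iff]
  rfl

theorem integral_areaMeasure (f : ℂ → ℂ) :
    ∫ z : RightHalfPlane, f z ∂areaMeasure = ∫ z in {z : ℂ | 0 < z.re}, f z := by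
  rw [← map_val_areaMeasure, measurableEmbedding_halfPlane_val.integral_map]

theorem areaMeasure_lt_top {E : Set RightHalfPlane} (hE : IsCompact E) : areaMeasure E < ∞ := by
  rw [areaMeasure, measurableEmbedding_halfPlane_val.comap_apply]
  exact (hE.image continuous_subtype_val).measure_lt_top

/-- The density of `inversionMeasure t` with respect to `areaMeasure`. -/
def inversionDensity (t : ℝ) (z : RightHalfPlane) : ℝ :=
  2 * Real.pi⁻¹ * (‖(z : ℂ)‖ ^ 2)⁻¹ * Real.exp (2 / t * (z : ℂ).re) * (z : ℂ).re

theorem RightHalfPlane.ne_zero (z : RightHalfPlane) : (z : ℂ) ≠ 0 := by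
  intro h
  have := z.2
  simp [h] at this

theorem inversionDensity_nonneg (t : ℝ) (z : RightHalfPlane) : 0 ≤ inversionDensity t z := by
  have := z.2
  unfold inversionDensity
  positivity

theorem continuous_inversionDensity (t : ℝ) : Continuous (inversionDensity t) := by
  unfold inversionDensity
  have : Continuous fun z : RightHalfPlane => (‖(z : ℂ)‖ ^ 2)⁻¹ :=
    Continuous.inv₀ (by fun_prop) fun z => by
      have := norm_pos_iff.2 z.ne_zero
      positivity
  fun_prop

theorem inversionMeasure_eq (t : ℝ) : inversionMeasure t =
    areaMeasure.withDensity (fun z => ENNReal.ofReal (inversionDensity t z)) := rfl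

theorem inversionMeasure_lt_top (t : ℝ) {E : Set RightHalfPlane} (hE : IsCompact E) :
    inversionMeasure t E < ∞ := by
  rw [inversionMeasure_eq, withDensity_apply _ hE.measurableSet]
  obtain ⟨C, hC⟩ := hE.exists_bound_of_continuousOn (continuous_inversionDensity t).continuousOn
  calc ∫⁻ z in E, ENNReal.ofReal (inversionDensity t z) ∂areaMeasure
      ≤ ∫⁻ _ in E, ENNReal.ofReal C ∂areaMeasure :=
        setLIntegral_mono' hE.measurableSet fun z hz =>
          ENNReal.ofReal_le_ofReal ((le_abs_self _).trans (hC z hz))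
    _ = ENNReal.ofReal C * areaMeasure E := by simp
    _ < ∞ := ENNReal.mul_lt_top ENNReal.ofReal_lt_top (areaMeasure_lt_top hE)

theorem integrable_inversionMeasure_iff {E : Type*} [NormedAddCommGroup E] [NormedSpace ℝ E]
    (t : ℝ) (f : RightHalfPlane → E) : Integrable f (inversionMeasure t) ↔
      Integrable (fun z => inversionDensity t z • f z) areaMeasure := by
  rw [inversionMeasure_eq, integrable_withDensity_iff_integrable_smul'
    (continuous_inversionDensity t).measurable.ennreal_ofReal (by simp)]
  simp_rw [ENNReal.toReal_ofReal (inversionDensity_nonneg t _)]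

theorem integral_inversionMeasure {E : Type*} [NormedAddCommGroup E] [NormedSpace ℝ E]
    (t : ℝ) (f : RightHalfPlane → E) : ∫ z, f z ∂inversionMeasure t =
      ∫ z, inversionDensity t z • f z ∂areaMeasure := by
  rw [inversionMeasure_eq, integral_withDensity_eq_integral_toReal_smul
    (continuous_inversionDensity t).measurable.ennreal_ofReal (by simp)]
  simp_rw [ENNReal.toReal_ofReal (inversionDensity_nonneg t _)]

/-- The density of μᵗ is designed so that |z|⁻² and e^{(2/t) Re z} cancel |z e^{-z/t}|², leaving the
Bergman weight times 2/π. -/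
theorem inversionDensity_mul (t : ℝ) (z : RightHalfPlane) (c d : ℂ) :
    inversionDensity t z • (((z : ℂ) * Complex.exp (-(z : ℂ) / t) * c) *
        conj ((z : ℂ) * Complex.exp (-(z : ℂ) / t) * d)) =
      2 / Real.pi * (c * conj d * ((z : ℂ).re : ℂ)) := by
  have hz : (z : ℂ) * conj (z : ℂ) = (‖(z : ℂ)‖ : ℂ) ^ 2 := Complex.mul_conj' _
  have hn : (‖(z : ℂ)‖ : ℂ) ≠ 0 := by exact_mod_cast norm_ne_zero_iff.2 z.ne_zero
  have he : Complex.exp (-(z : ℂ) / t) * conj (Complex.exp (-(z : ℂ) / t)) *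
      Complex.exp (2 / t * (z : ℂ).re) = 1 := by
    rw [← Complex.exp_conj, ← Complex.exp_add, ← Complex.exp_add, Complex.exp_eq_one_iff]
    refine ⟨0, ?_⟩
    have : (2 * (z : ℂ).re : ℂ) = z + conj (z : ℂ) := by rw [Complex.add_conj]; push_cast; ring
    simp only [map_div₀, map_neg, Complex.conj_ofReal]
    rw [show (2 / t * (z : ℂ).re : ℂ) = (2 * (z : ℂ).re) / t by ring, this]
    push_cast
    ring
  rw [inversionDensity, Complex.real_smul]
  push_cast
  simp only [map_mul]
  calc _ = 2 * (Real.pi : ℂ)⁻¹ * (((‖(z : ℂ)‖ : ℂ) ^ 2)⁻¹ * ((z : ℂ) * conj (z : ℂ))) *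
        (Complex.exp (-(z : ℂ) / t) * conj (Complex.exp (-(z : ℂ) / t)) *
      Complex.exp (2 / t * (z : ℂ).re)) * (c * conj d * ((z : ℂ).re : ℂ)) := by ring
    _ = _ := by
      rw [he, hz, inv_mul_cancel₀ (pow_ne_zero 2 hn)]
      ring

theorem inversionDensity_mul_normSq (t : ℝ) (z : RightHalfPlane) (c : ℂ) :
    inversionDensity t z • ‖(z : ℂ) * Complex.exp (-(z : ℂ) / t) * c‖ ^ 2 =
      2 / Real.pi * (‖c‖ ^ 2 * (z : ℂ).re) := by
  have h := inversionDensity_mul t z c c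
  rw [Complex.mul_conj', Complex.mul_conj', Complex.real_smul] at h
  rw [smul_eq_mul]
  exact_mod_cast h

theorem mul_exp_mul_inv_mul_exp (t : ℝ) (z : RightHalfPlane) (c : ℂ) :
    (z : ℂ) * Complex.exp (-(z : ℂ) / t) * ((z : ℂ)⁻¹ * Complex.exp ((z : ℂ) / t) * c) = c := by
  have h : Complex.exp (-(z : ℂ) / t) * Complex.exp ((z : ℂ) / t) = 1 := by
    rw [← Complex.exp_add]
    ring_nf
    simp
  calc _ = ((z : ℂ) * (z : ℂ)⁻¹) * (Complex.exp (-(z : ℂ) / t) * Complex.exp ((z : ℂ) / t)) * c := by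
        ring
    _ = c := by rw [h, mul_inv_cancel₀ z.ne_zero]; ring

/-- The factor z e^{-z/t} has no zeros on the half plane, so division by it preserves holomorphy;
the integrability conditions correspond by the cancellation in the density. -/
theorem mem_rangeSpace_iff {t : ℝ} {F : RightHalfPlane → ℂ} :
    F ∈ rangeSpace t ↔ IsHolomorphic F ∧ MemLp F 2 (inversionMeasure t) := by
  have key : ∀ f : RightHalfPlane → ℂ,
      Integrable (fun z : RightHalfPlane => ‖(z : ℂ) * Complex.exp (-(z : ℂ) / t) * f z‖ ^ 2)
        (inversionMeasure t) ↔
      Integrable (fun z : RightHalfPlane => ‖f z‖ ^ 2 * (z : ℂ).re) areaMeasure := by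
    intro f
    rw [integrable_inversionMeasure_iff]
    simp_rw [inversionDensity_mul_normSq]
    rw [integrable_const_mul_iff]
    exact (isUnit_iff_ne_zero.2 (by positivity))
  constructor
  · rintro ⟨f, ⟨⟨f', hf', hff'⟩, hf2⟩, rfl⟩
    have hhol : IsHolomorphic (LinearMap.mulLeft ℂ
        (fun z : RightHalfPlane => (z : ℂ) * Complex.exp (-(z : ℂ) / t)) f) :=
      ⟨fun z => z * Complex.exp (-z / t) * f' z,
        DifferentiableOn.mul (by fun_prop) hf', fun z => by simp [hff' z]⟩
    refine ⟨hhol, ?_⟩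
    rw [memLp_two_iff_integrable_sq_norm hhol.continuous.aestronglyMeasurable]
    exact (key f).2 hf2
  · rintro ⟨hF, hF2⟩
    rw [memLp_two_iff_integrable_sq_norm hF.continuous.aestronglyMeasurable] at hF2
    obtain ⟨F', hF', hFF'⟩ := hF
    refine ⟨fun z => (z : ℂ)⁻¹ * Complex.exp ((z : ℂ) / t) * F z, ⟨?_, ?_⟩, ?_⟩
    · refine ⟨fun z => z⁻¹ * Complex.exp (z / t) * F' z, ?_, fun z => by simp [hFF' z]⟩
      refine DifferentiableOn.mul (DifferentiableOn.mul ?_ (by fun_prop)) hF'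
      exact differentiableOn_inv.mono fun z (hz : 0 < z.re) => RightHalfPlane.ne_zero ⟨z, hz⟩
    · rw [← key]
      simp_rw [mul_exp_mul_inv_mul_exp]
      exact hF2
    · ext z
      simpa using mul_exp_mul_inv_mul_exp t z (F z)

theorem rangeNorm_eq (t : ℝ) (F : RightHalfPlane → ℂ) :
    rangeNorm t F = Real.sqrt (∫ z, ‖F z‖ ^ 2 ∂inversionMeasure t) := by
  have hpi := Real.pi_pos
  have h1 : ∫ z, ‖F z‖ ^ 2 ∂inversionMeasure t = 2 / Real.pi *
      ∫ z : RightHalfPlane, ‖(z : ℂ)⁻¹ * Complex.exp ((z : ℂ) / t) * F z‖ ^ 2 * (z : ℂ).re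
        ∂areaMeasure := by
    rw [integral_inversionMeasure, ← integral_const_mul]
    congr 1 with z
    rw [← inversionDensity_mul_normSq, mul_exp_mul_inv_mul_exp]
  -- Under the square root the constants combine to π^{-3/2} · 2π^{1/2} = 2/π.
  have h2 : Real.pi ^ (-(3 / 4) : ℝ) = Real.sqrt (Real.pi ^ (-(3 / 2) : ℝ)) := by
    rw [Real.sqrt_eq_rpow, ← Real.rpow_mul hpi.le]
    norm_num
  rw [rangeNorm, bergmanNorm, h1, h2, ← Real.sqrt_mul (by positivity)]
  congr 1
  rw [← mul_assoc]
  congr 1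
  rw [Real.sqrt_eq_rpow, mul_left_comm, ← Real.rpow_add hpi]
  norm_num [Real.rpow_neg_one]
  rfl

/-! ### Reproducing kernel of the range space -/

/-- The reproducing kernel of the range space. -/
def rangeKernel (t : ℝ) (z w : ℂ) : ℂ :=
  z * Complex.exp (-z / t) * (2 * (conj w * Complex.exp (-conj w / t)) * (1 / (z + conj w) ^ 3))

theorem add_conj_ne_zero {z w : ℂ} (hz : 0 < z.re) (hw : 0 < w.re) : z + conj w ≠ 0 := by
  intro h
  have := congrArg Complex.re h
  simp at this
  linarith

theorem rangeKernel_mem (t : ℝ) (w : RightHalfPlane) :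
    (fun z : RightHalfPlane => rangeKernel t z w) ∈ rangeSpace t := by
  refine ⟨fun z => 2 * (conj (w : ℂ) * Complex.exp (-conj (w : ℂ) / t)) *
    (1 / (z + conj (w : ℂ)) ^ 3), ?_, rfl⟩
  refine weightedBergman.smul_mem (2 * (conj (w : ℂ) * Complex.exp (-conj (w : ℂ) / t)))
    (x := fun z => 1 / ((z : ℂ) + conj (w : ℂ)) ^ 3) ⟨?_, ?_⟩
  · refine ⟨fun z => 1 / (z + conj (w : ℂ)) ^ 3, ?_, fun z => rfl⟩
    exact DifferentiableOn.div (by fun_prop) (by fun_prop)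
      fun z hz => pow_ne_zero 3 (add_conj_ne_zero hz w.2)
  · exact (integrable_areaMeasure_iff _).2 (integrableOn_normSq_kernel w.2)

/-- This is the Bergman reproducing formula conjugated by z e^{-z/t}. The factor 2 in the kernel
normalises it: 2/π · 2 · π/4 = 1. -/
theorem integral_mul_conj_rangeKernel {t : ℝ} {F : RightHalfPlane → ℂ} (hF : F ∈ rangeSpace t)
    (w : RightHalfPlane) :
    ∫ z : RightHalfPlane, F z * conj (rangeKernel t z w) ∂inversionMeasure t = F w := by
  have hint : Integrable (fun z : RightHalfPlane => F z * conj (rangeKernel t z w))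
      (inversionMeasure t) :=
    (mem_rangeSpace_iff.1 hF).2.integrable_mul (mem_rangeSpace_iff.1 (rangeKernel_mem t w)).2.star
  obtain ⟨f, ⟨⟨f', hf', hff'⟩, hf2⟩, rfl⟩ := hF
  set c : ℂ := 2 * (conj (w : ℂ) * Complex.exp (-conj (w : ℂ) / t)) with hc
  have hc0 : conj c ≠ 0 := by
    simp [hc, w.ne_zero, Complex.exp_ne_zero]
  have hpi : (Real.pi : ℂ) ≠ 0 := by exact_mod_cast Real.pi_ne_zero
  have hpt : ∀ z : RightHalfPlane, inversionDensity t z • ((LinearMap.mulLeft ℂ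
      (fun z : RightHalfPlane => (z : ℂ) * Complex.exp (-(z : ℂ) / t)) f) z *
        conj (rangeKernel t z w)) = 2 / Real.pi * conj c *
      (f' z * conj (1 / ((z : ℂ) + conj (w : ℂ)) ^ 3) * ((z : ℂ).re : ℂ)) := by
    intro z
    have := inversionDensity_mul t z (f z) (c * (1 / ((z : ℂ) + conj (w : ℂ)) ^ 3))
    refine Eq.trans this ?_
    rw [hff', map_mul]
    ring
  rw [integrable_inversionMeasure_iff] at hint
  rw [integral_inversionMeasure]
  simp_rw [hpt] at hint ⊢
  rw [integrable_const_mul_iff (isUnit_iff_ne_zero.2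
    (mul_ne_zero (div_ne_zero two_ne_zero hpi) hc0)), integrable_areaMeasure_iff
    (fun z : ℂ => f' z * conj (1 / (z + conj (w : ℂ)) ^ 3) * (z.re : ℂ))] at hint
  rw [integral_const_mul, integral_areaMeasure
    (fun z : ℂ => f' z * conj (1 / (z + conj (w : ℂ)) ^ 3) * (z.re : ℂ)),
    integral_halfPlane_mul_kernel w.2 hf' hint]
  simp only [LinearMap.mulLeft_apply, Pi.mul_apply, hff', hc, map_mul, map_ofNat,
    Complex.conj_conj, ← Complex.exp_conj, map_div₀, map_neg, Complex.conj_ofReal]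
  field_simp
  ring

/-! ### Fourier uniqueness -/

theorem MeasurableEmbedding.map_measure_injective {α β : Type*} [MeasurableSpace α]
    [MeasurableSpace β] {X : α → β} (hX : MeasurableEmbedding X) :
    Function.Injective fun μ : Measure α => μ.map X := by
  intro μ ν h
  ext s _
  have h2 := congrArg (fun ρ : Measure β => ρ (X '' s)) h
  simpa [hX.map_apply, Set.preimage_image_eq _ hX.injective] using h2

theorem charFun_map_withDensity_ofReal {α : Type*} [MeasurableSpace α] {σ : Measure α} {X : α → ℝ}
    (hX : Measurable X) {h : α → ℝ} (hh : AEMeasurable h σ) (y : ℝ) :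
    charFun ((σ.withDensity fun a => ENNReal.ofReal (h a)).map X) y =
      ∫ a, ((max (h a) 0 : ℝ) : ℂ) * Complex.exp (y * X a * Complex.I) ∂σ := by
  rw [charFun_apply_real, integral_map hX.aemeasurable (by fun_prop),
    integral_withDensity_eq_integral_toReal_smul₀ hh.ennreal_ofReal (by simp)]
  simp [ENNReal.toReal_ofReal', Complex.real_smul]

/-- The positive and negative parts of h are densities of finite measures whose images under X have
the same characteristic function. The images agree, hence so do the measures, since X is an
embedding. -/
theorem ae_eq_zero_of_integral_exp_mul_ofReal {α : Type*} [MeasurableSpace α] {σ : Measure α}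
    {X : α → ℝ} (hX : MeasurableEmbedding X) {h : α → ℝ} (hh : Integrable h σ)
    (h0 : ∀ y : ℝ, ∫ a, (h a : ℂ) * Complex.exp (y * X a * Complex.I) ∂σ = 0) :
    h =ᵐ[σ] 0 := by
  have hp : ∫⁻ a, ENNReal.ofReal (h a) ∂σ ≠ ∞ := hh.lintegral_lt_top.ne
  have hneg : Integrable (fun a => -h a) σ := hh.neg
  have hn : ∫⁻ a, ENNReal.ofReal (-h a) ∂σ ≠ ∞ := hneg.lintegral_lt_top.ne
  have : IsFiniteMeasure (σ.withDensity fun a => ENNReal.ofReal (h a)) :=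
    isFiniteMeasure_withDensity hp
  have : IsFiniteMeasure (σ.withDensity fun a => ENNReal.ofReal (-h a)) :=
    isFiniteMeasure_withDensity hn
  have hexp : ∀ {k : α → ℝ}, Integrable k σ → ∀ y : ℝ,
      Integrable (fun a => (k a : ℂ) * Complex.exp (y * X a * Complex.I)) σ := by
    intro k hk y
    refine hk.ofReal.mul_bdd (c := 1) ?_ (ae_of_all _ fun a => ?_)
    · have := hX.measurable
      exact (by fun_prop : Measurable fun a =>
        Complex.exp (y * X a * Complex.I)).aestronglyMeasurable
    · rw [← Complex.ofReal_mul, Complex.norm_exp_ofReal_mul_I]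
  have heq : (σ.withDensity fun a => ENNReal.ofReal (h a)).map X =
      (σ.withDensity fun a => ENNReal.ofReal (-h a)).map X := by
    refine Measure.ext_of_charFun (funext fun y => ?_)
    rw [charFun_map_withDensity_ofReal hX.measurable hh.aemeasurable,
      charFun_map_withDensity_ofReal hX.measurable hneg.aemeasurable, ← sub_eq_zero,
      ← integral_sub (hexp hh.pos_part y) (hexp hh.neg_part y), ← h0 y]
    congr 1 with a
    rw [← sub_mul, ← Complex.ofReal_sub]
    congr 2
    rcases le_total (h a) 0 with ha | ha
    · rw [max_eq_right ha, max_eq_left (by linarith)]; ring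
    · rw [max_eq_left ha, max_eq_right (by linarith)]; ring
  have h2 := (withDensity_eq_iff hh.aemeasurable.ennreal_ofReal
    hneg.aemeasurable.ennreal_ofReal hp).1 (hX.map_measure_injective heq)
  filter_upwards [h2] with a ha
  rcases le_total (h a) 0 with h3 | h3
  · rw [ENNReal.ofReal_of_nonpos h3, eq_comm] at ha
    have h4 : -h a ≤ 0 := ENNReal.ofReal_eq_zero.1 ha
    exact le_antisymm h3 (neg_nonpos.1 h4)
  · have h4 : ENNReal.ofReal (-h a) = 0 := ENNReal.ofReal_of_nonpos (by linarith)
    exact le_antisymm (ENNReal.ofReal_eq_zero.1 (ha.trans h4)) h3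

/-- Uniqueness of the Fourier transform of an integrable function. -/
theorem ae_eq_zero_of_integral_exp_mul {α : Type*} [MeasurableSpace α] {σ : Measure α}
    {X : α → ℝ} (hX : MeasurableEmbedding X) {h : α → ℂ} (hh : Integrable h σ)
    (h0 : ∀ y : ℝ, ∫ a, h a * Complex.exp (y * X a * Complex.I) ∂σ = 0) :
    h =ᵐ[σ] 0 := by
  have hexp : ∀ {k : α → ℂ}, Integrable k σ → ∀ y : ℝ,
      Integrable (fun a => k a * Complex.exp (y * X a * Complex.I)) σ := by
    intro k hk y
    refine hk.mul_bdd (c := 1) ?_ (ae_of_all _ fun a => ?_)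
    · have := hX.measurable
      exact (by fun_prop : Measurable fun a =>
        Complex.exp (y * X a * Complex.I)).aestronglyMeasurable
    · rw [← Complex.ofReal_mul, Complex.norm_exp_ofReal_mul_I]
  have hconj : Integrable (fun a => conj (h a)) σ :=
    (LinearIsometryEquiv.integrable_comp_iff Complex.conjLIE).2 hh
  -- Conjugation replaces y by -y, so the hypothesis passes to the conjugate and thus to the real
  -- and imaginary parts.
  have h1 : ∀ y : ℝ, ∫ a, conj (h a) * Complex.exp (y * X a * Complex.I) ∂σ = 0 := by
    intro y
    have h2 := congrArg conj (h0 (-y))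
    rw [← integral_conj, map_zero] at h2
    rw [← h2]
    congr 1 with a
    rw [map_mul, ← Complex.exp_conj]
    congr 2
    simp
  have hre : (fun a => (h a).re) =ᵐ[σ] 0 := by
    refine ae_eq_zero_of_integral_exp_mul_ofReal hX hh.re fun y => ?_
    have h2 : ∀ a, ((h a).re : ℂ) * Complex.exp (y * X a * Complex.I) = 1 / 2 *
        (h a * Complex.exp (y * X a * Complex.I) +
          conj (h a) * Complex.exp (y * X a * Complex.I)) := fun a => by
      rw [← add_mul, Complex.add_conj]
      push_cast
      ring
    simp_rw [h2]
    rw [integral_const_mul, integral_add (hexp hh y) (hexp hconj y), h0, h1]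
    simp
  have him : (fun a => (h a).im) =ᵐ[σ] 0 := by
    refine ae_eq_zero_of_integral_exp_mul_ofReal hX hh.im fun y => ?_
    have h2 : ∀ a, ((h a).im : ℂ) * Complex.exp (y * X a * Complex.I) = 1 / (2 * Complex.I) *
        (h a * Complex.exp (y * X a * Complex.I) -
          conj (h a) * Complex.exp (y * X a * Complex.I)) := fun a => by
      rw [← sub_mul, Complex.sub_conj]
      have := Complex.I_ne_zero
      push_cast
      field_simp
    simp_rw [h2]
    rw [integral_const_mul, integral_sub (hexp hh y) (hexp hconj y), h0, h1]
    simp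
  filter_upwards [hre, him] with a h2 h3
  exact Complex.ext h2 h3

/-! ### Evaluation vectors in the source space -/

theorem measurableEmbedding_inv_sub (t : ℝ) : MeasurableEmbedding fun τ : ℝ => (t - τ)⁻¹ :=
  Measurable.measurableEmbedding (by fun_prop) fun x y h => by
    have := inv_injective h
    linarith

instance (t : ℝ) : IsFiniteMeasure (sourceMeasure t) := by
  refine isFiniteMeasure_withDensity (ne_of_lt ?_)
  calc ∫⁻ τ in Set.Ioo 0 t, ENNReal.ofReal (τ ^ 2 / t ^ 2)
      ≤ ∫⁻ _ in Set.Ioo 0 t, 1 := by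
        refine setLIntegral_mono' measurableSet_Ioo fun τ hτ => ?_
        rw [← ENNReal.ofReal_one]
        refine ENNReal.ofReal_le_ofReal (div_le_one_of_le₀ ?_ (sq_nonneg _))
        exact pow_le_pow_left₀ hτ.1.le hτ.2.le 2
    _ < ∞ := by simp

theorem ae_sourceMeasure_mem (t : ℝ) : ∀ᵐ τ ∂sourceMeasure t, τ ∈ Set.Ioo 0 t :=
  (withDensity_absolutelyContinuous _ _).ae_le (ae_restrict_mem measurableSet_Ioo)

theorem integrable_sourceMeasure_iff {E : Type*} [NormedAddCommGroup E] [NormedSpace ℝ E]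
    (t : ℝ) (f : ℝ → E) : Integrable f (sourceMeasure t) ↔
      IntegrableOn (fun τ => (τ ^ 2 / t ^ 2) • f τ) (Set.Ioo 0 t) := by
  rw [sourceMeasure, integrable_withDensity_iff_integrable_smul' (by fun_prop) (by simp)]
  simp_rw [ENNReal.toReal_ofReal (div_nonneg (sq_nonneg _) (sq_nonneg t))]
  rfl

theorem integral_sourceMeasure {E : Type*} [NormedAddCommGroup E] [NormedSpace ℝ E]
    (t : ℝ) (f : ℝ → E) : ∫ τ, f τ ∂sourceMeasure t =
      ∫ τ in Set.Ioo 0 t, (τ ^ 2 / t ^ 2) • f τ := by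
  rw [sourceMeasure, integral_withDensity_eq_integral_toReal_smul (by fun_prop) (by simp)]
  simp_rw [ENNReal.toReal_ofReal (div_nonneg (sq_nonneg _) (sq_nonneg t))]

/-- The kernel `z (t-τ)⁻² e^{-z/(t-τ)}` of the transform. -/
def laplaceKernel (t : ℝ) (z : ℂ) (τ : ℝ) : ℂ :=
  z / ((t : ℂ) - τ) ^ 2 * Complex.exp (-(z / ((t : ℂ) - τ)))

theorem measurable_laplaceKernel (t : ℝ) :
    Measurable fun p : ℂ × ℝ => laplaceKernel t p.1 p.2 := by
  unfold laplaceKernel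
  fun_prop

/-- With s = 1/(t-τ) the kernel is z s² e^{-zs}, and e^{δs} ≥ (δs)²/2 absorbs s². The bound is
uniform up to the singular endpoint τ = t. -/
theorem norm_laplaceKernel_le {t δ : ℝ} (hδ : 0 < δ) {z : ℂ} (hz : δ ≤ z.re) {τ : ℝ}
    (hτ : τ < t) : ‖laplaceKernel t z τ‖ ≤ ‖z‖ * (2 / δ ^ 2) := by
  set s := (t - τ)⁻¹ with hs
  have hs0 : 0 < s := inv_pos.2 (sub_pos.2 hτ)
  have h1 : laplaceKernel t z τ = z * ((s ^ 2 : ℝ) : ℂ) * Complex.exp (-(z * s)) := by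
    rw [laplaceKernel, hs]
    push_cast
    rw [div_eq_mul_inv, div_eq_mul_inv, inv_pow]
  have h2 : Real.exp (-(z.re * s)) * s ^ 2 ≤ 2 / δ ^ 2 := by
    have h3 : Real.exp (-(z.re * s)) ≤ Real.exp (-(δ * s)) := by gcongr
    have h4 := Real.quadratic_le_exp_of_nonneg (mul_pos hδ hs0).le
    rw [Real.exp_neg (δ * s)] at h3
    have h5 : (δ * s) ^ 2 / 2 ≤ Real.exp (δ * s) := by
      have := mul_pos hδ hs0
      linarith
    calc Real.exp (-(z.re * s)) * s ^ 2 ≤ (Real.exp (δ * s))⁻¹ * s ^ 2 := by gcongr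
      _ ≤ ((δ * s) ^ 2 / 2)⁻¹ * s ^ 2 := by gcongr
      _ = 2 / δ ^ 2 := by field_simp
  rw [h1, norm_mul, norm_mul, Complex.norm_exp, Complex.norm_real, Real.norm_of_nonneg (by positivity),
    mul_assoc]
  gcongr
  simpa [mul_comm] using h2

theorem memLp_conj_laplaceKernel (t : ℝ) (z : RightHalfPlane) :
    MemLp (fun τ => conj (laplaceKernel t z τ)) 2 (sourceMeasure t) := by
  refine MemLp.of_bound ?_ (‖(z : ℂ)‖ * (2 / (z : ℂ).re ^ 2)) ?_
  · have h := (measurable_laplaceKernel t).comp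
      (measurable_const.prodMk measurable_id : Measurable fun τ : ℝ => ((z : ℂ), τ))
    exact (Complex.continuous_conj.measurable.comp h).aestronglyMeasurable
  · filter_upwards [ae_sourceMeasure_mem t] with τ hτ
    rw [RCLike.norm_conj]
    exact norm_laplaceKernel_le z.2 le_rfl hτ.2

/-- The vector of `L²` that represents the evaluation of the transform at `z`. -/
def atom (t : ℝ) (z : RightHalfPlane) : Lp ℂ 2 (sourceMeasure t) :=
  (memLp_conj_laplaceKernel t z).toLp _

theorem inner_atom_ae (t : ℝ) (z : RightHalfPlane) (g : Lp ℂ 2 (sourceMeasure t)) :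
    (fun τ => inner ℂ (atom t z τ) (g τ)) =ᵐ[sourceMeasure t]
      fun τ => laplaceKernel t z τ * g τ := by
  filter_upwards [(memLp_conj_laplaceKernel t z).coeFn_toLp] with τ h1
  rw [atom, h1, RCLike.inner_apply, Complex.conj_conj, mul_comm]

theorem inner_atom (t : ℝ) (z : RightHalfPlane) (g : Lp ℂ 2 (sourceMeasure t)) :
    inner ℂ (atom t z) g = ∫ τ, laplaceKernel t z τ * g τ ∂sourceMeasure t := by
  rw [L2.inner_def, integral_congr_ae (inner_atom_ae t z g)]

theorem transformIntegrand_eq {t : ℝ} (ht : 0 < t) (g : ℝ → ℂ) (z : RightHalfPlane) (τ : ℝ) :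
    transformIntegrand t g z τ =
      (t : ℂ) ^ 2 * ((τ ^ 2 / t ^ 2) • (laplaceKernel t z τ * g τ)) := by
  have : (t : ℂ) ≠ 0 := by exact_mod_cast ht.ne'
  rw [transformIntegrand, laplaceKernel, Complex.real_smul]
  push_cast
  field_simp

theorem integrableOn_transformIntegrand {t : ℝ} (ht : 0 < t) (g : Lp ℂ 2 (sourceMeasure t))
    (z : RightHalfPlane) : IntegrableOn (transformIntegrand t g z) (Set.Ioo 0 t) := by
  have h := L2.integrable_inner (𝕜 := ℂ) (atom t z) g
  rw [integrable_congr (inner_atom_ae t z g), integrable_sourceMeasure_iff] at h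
  have h2 : transformIntegrand t g z = fun τ =>
      (t : ℂ) ^ 2 * ((τ ^ 2 / t ^ 2) • (laplaceKernel t z τ * g τ)) :=
    funext fun τ => transformIntegrand_eq ht g z τ
  rw [h2]
  exact h.const_mul _

theorem transform_eq_inner {t : ℝ} (ht : 0 < t) (g : Lp ℂ 2 (sourceMeasure t))
    (z : RightHalfPlane) : transform t g z = inner ℂ (atom t z) g := by
  have : (t : ℂ) ≠ 0 := by exact_mod_cast ht.ne'
  rw [inner_atom, integral_sourceMeasure, transform]
  simp_rw [transformIntegrand_eq ht]
  rw [integral_const_mul]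
  field_simp

/-- At z = 1 - iy the transform is 1 - iy times the Fourier integral, in the variable s = 1/(t-τ),
of the integrable function `laplaceKernel t 1 τ * g τ`. Uniqueness kills this product, and the
kernel does not vanish on (0, t). -/
theorem eq_zero_of_inner_atom {t : ℝ} {g : Lp ℂ 2 (sourceMeasure t)}
    (h : ∀ z, inner ℂ (atom t z) g = 0) : g = 0 := by
  have hone : ∀ y : ℝ, 0 < (1 - y * Complex.I : ℂ).re := fun y => by simp
  set X : ℝ → ℝ := fun τ => (t - τ)⁻¹ with hX
  have hk : ∀ y τ : ℝ, laplaceKernel t (1 - y * Complex.I) τ * g τ = (1 - y * Complex.I) *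
      (laplaceKernel t 1 τ * g τ * Complex.exp (y * X τ * Complex.I)) := by
    intro y τ
    have : Complex.exp (-((1 - y * Complex.I) / ((t : ℂ) - τ))) =
        Complex.exp (-(1 / ((t : ℂ) - τ))) * Complex.exp (y * X τ * Complex.I) := by
      rw [← Complex.exp_add, hX]
      push_cast
      ring_nf
    rw [laplaceKernel, laplaceKernel, this]
    ring
  have hint : Integrable (fun τ => laplaceKernel t 1 τ * g τ) (sourceMeasure t) := by
    have h1 := L2.integrable_inner (𝕜 := ℂ) (atom t ⟨1, by simp⟩) g
    rwa [integrable_congr (inner_atom_ae t _ g)] at h1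
  have h0 := ae_eq_zero_of_integral_exp_mul (measurableEmbedding_inv_sub t) hint fun y => by
    have h2 := h ⟨1 - y * Complex.I, hone y⟩
    rw [inner_atom] at h2
    simp_rw [hk] at h2
    rw [integral_const_mul] at h2
    refine (mul_eq_zero.1 h2).resolve_left fun h3 => ?_
    have := hone y
    simp [h3] at this
  refine Lp.ext ?_
  filter_upwards [h0, ae_sourceMeasure_mem t, Lp.coeFn_zero ℂ 2 (sourceMeasure t)] with τ h1 h2 h3
  rw [h3]
  refine (mul_eq_zero.1 h1).resolve_left ?_
  have h4 : (t : ℂ) - τ ≠ 0 := by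
    rw [← Complex.ofReal_sub]
    exact_mod_cast (sub_pos.2 h2.2).ne'
  exact mul_ne_zero (div_ne_zero one_ne_zero (pow_ne_zero 2 h4)) (Complex.exp_ne_zero _)

theorem dense_span_atom (t : ℝ) :
    Dense (Submodule.span ℂ (Set.range (atom t)) : Set (Lp ℂ 2 (sourceMeasure t))) := by
  rw [Submodule.dense_iff_topologicalClosure_eq_top, Submodule.topologicalClosure_eq_top_iff,
    Submodule.eq_bot_iff]
  exact fun g hg => eq_zero_of_inner_atom fun z => (Submodule.mem_orthogonal _ g).1 hg _
    (Submodule.subset_span (Set.mem_range_self z))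

/-! ### Gram matrix of the evaluation vectors -/

theorem tendsto_pow_mul_cexp_neg_mul {a : ℂ} (ha : 0 < a.re) (n : ℕ) :
    Tendsto (fun s : ℝ => (s : ℂ) ^ n * Complex.exp (-(a * s))) atTop (𝓝 0) := by
  rw [tendsto_zero_iff_norm_tendsto_zero]
  have h := tendsto_rpow_mul_exp_neg_mul_atTop_nhds_zero n a.re ha
  refine h.congr' ?_
  filter_upwards [eventually_ge_atTop 0] with s hs
  rw [norm_mul, norm_pow, Complex.norm_real, Real.norm_of_nonneg hs, Complex.norm_exp,
    Real.rpow_natCast]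
  simp

/-- An antiderivative of `τ² t⁻² (t-τ)⁻⁴ e^{-a/(t-τ)}`, as a function of `s = 1/(t-τ)`. -/
def kernelPrimitive (t : ℝ) (a : ℂ) (s : ℝ) : ℂ :=
  -((((s : ℂ) - 1 / t) ^ 2 / a + 2 * ((s : ℂ) - 1 / t) / a ^ 2 + 2 / a ^ 3) *
    Complex.exp (-(a * s)))

theorem tendsto_kernelPrimitive {t : ℝ} {a : ℂ} (ha : 0 < a.re) :
    Tendsto (kernelPrimitive t a) atTop (𝓝 0) := by
  have h0 := tendsto_pow_mul_cexp_neg_mul ha 0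
  have h1 := tendsto_pow_mul_cexp_neg_mul ha 1
  have h2 := tendsto_pow_mul_cexp_neg_mul ha 2
  have h := ((h2.const_mul (1 / a)).add (h1.const_mul (2 / a ^ 2 - 2 / (t * a)))).add
    (h0.const_mul (1 / (t ^ 2 * a) - 2 / (t * a ^ 2) + 2 / a ^ 3))
  have h3 := h.neg
  simp only [mul_zero, add_zero, neg_zero] at h3
  refine h3.congr fun s => ?_
  rw [kernelPrimitive]
  ring

theorem hasDerivAt_kernelPrimitive {t : ℝ} {a : ℂ} (ha : a ≠ 0) (s : ℝ) :
    HasDerivAt (kernelPrimitive t a)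
      (((s : ℂ) - 1 / t) ^ 2 * Complex.exp (-(a * s))) s := by
  have hs : HasDerivAt (fun s : ℝ => (s : ℂ)) 1 s := Complex.ofRealCLM.hasDerivAt
  have h1 := hs.sub_const (1 / (t : ℂ))
  have h2 := ((((h1.pow 2).div_const a).add ((h1.const_mul 2).div_const (a ^ 2))).add_const
    (2 / a ^ 3)).mul (hs.const_mul a).neg.cexp
  refine h2.neg.congr_deriv ?_
  simp
  field_simp
  ring

theorem inner_atom_atom_ae {t : ℝ} (z w : RightHalfPlane) :
    (fun τ => laplaceKernel t z τ * atom t w τ) =ᵐ[sourceMeasure t]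
      fun τ => laplaceKernel t z τ * conj (laplaceKernel t w τ) := by
  filter_upwards [(memLp_conj_laplaceKernel t w).coeFn_toLp] with τ h1
  rw [atom, h1]

/-- For s = 1/(t-τ), τ/(t(t-τ)) = s - 1/t and ds = dτ/(t-τ)², so the integral is that of (s-1/t)²
e^{-as} over (1/t, ∞), up to the factor z w̄. The primitive vanishes at infinity because Re a > 0;
at s = 1/t only its term 2/a³ survives. -/
theorem inner_atom_atom {t : ℝ} (ht : 0 < t) (z w : RightHalfPlane) :
    inner ℂ (atom t z) (atom t w) = rangeKernel t z w := by
  set a : ℂ := z + conj (w : ℂ) with ha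
  have ha0 : a ≠ 0 := add_conj_ne_zero z.2 w.2
  have hare : 0 < a.re := by simpa [ha] using add_pos z.2 w.2
  have htc : (t : ℂ) ≠ 0 := by exact_mod_cast ht.ne'
  have hint : Integrable (fun τ => laplaceKernel t z τ * conj (laplaceKernel t w τ))
      (sourceMeasure t) := by
    have h1 := L2.integrable_inner (𝕜 := ℂ) (atom t z) (atom t w)
    rwa [integrable_congr ((inner_atom_ae t z _).trans (inner_atom_atom_ae z w))] at h1
  rw [inner_atom, integral_congr_ae (inner_atom_atom_ae z w), integral_sourceMeasure,
    ← integral_Ioc_eq_integral_Ioo, ← intervalIntegral.integral_of_le ht.le]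
  rw [integrable_sourceMeasure_iff, ← integrableOn_Ioc_iff_integrableOn_Ioo,
    ← intervalIntegrable_iff_integrableOn_Ioc_of_le ht.le] at hint
  have hX : ∀ τ ∈ Set.Ioo 0 t, HasDerivAt (fun τ => (t - τ)⁻¹) (1 / (t - τ) ^ 2) τ := by
    intro τ hτ
    have := ((hasDerivAt_id τ).const_sub t).inv (sub_pos.2 hτ.2).ne'
    exact this.congr_deriv (by simp)
  have hderiv : ∀ τ ∈ Set.Ioo 0 t,
      HasDerivAt (fun τ => (z : ℂ) * conj (w : ℂ) * kernelPrimitive t a ((t - τ)⁻¹))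
        ((τ ^ 2 / t ^ 2) • (laplaceKernel t z τ * conj (laplaceKernel t w τ))) τ := by
    intro τ hτ
    have hne : (t : ℂ) - τ ≠ 0 := by
      rw [← Complex.ofReal_sub]
      exact_mod_cast (sub_pos.2 hτ.2).ne'
    have h1 := ((hasDerivAt_kernelPrimitive (t := t) ha0 _).scomp τ (hX τ hτ)).const_mul
      ((z : ℂ) * conj (w : ℂ))
    refine h1.congr_deriv ?_
    have hexp : Complex.exp (-((z : ℂ) / ((t : ℂ) - τ))) *
        Complex.exp (-(conj (w : ℂ) / ((t : ℂ) - τ))) =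
        Complex.exp (-(a * ((t : ℂ) - τ)⁻¹)) := by
      rw [← Complex.exp_add, ha]
      ring_nf
    have hu : ((t : ℂ) - τ)⁻¹ - 1 / t = τ / (t * (t - τ)) := by
      field_simp
      ring
    simp only [laplaceKernel, Complex.real_smul, map_mul, map_div₀, map_pow, map_sub,
      Complex.conj_ofReal, ← Complex.exp_conj, map_neg]
    push_cast
    rw [hu, ← hexp]
    field_simp
  have hlim0 : Tendsto (fun τ => (z : ℂ) * conj (w : ℂ) * kernelPrimitive t a ((t - τ)⁻¹))
      (𝓝[>] 0) (𝓝 ((z : ℂ) * conj (w : ℂ) * kernelPrimitive t a ((t - 0)⁻¹))) := by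
    refine Tendsto.mono_left ?_ nhdsWithin_le_nhds
    refine Tendsto.const_mul _ ?_
    have hc : ContinuousAt (fun τ : ℝ => (t - τ)⁻¹) 0 :=
      ContinuousAt.inv₀ (by fun_prop) (by simpa using ht.ne')
    exact (hasDerivAt_kernelPrimitive ha0 _).continuousAt.tendsto.comp hc.tendsto
  have hlimt : Tendsto (fun τ => (z : ℂ) * conj (w : ℂ) * kernelPrimitive t a ((t - τ)⁻¹))
      (𝓝[<] t) (𝓝 ((z : ℂ) * conj (w : ℂ) * 0)) := by
    refine Tendsto.const_mul _ ((tendsto_kernelPrimitive hare).comp ?_)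
    refine tendsto_inv_nhdsGT_zero.comp (tendsto_nhdsWithin_iff.2 ⟨?_, ?_⟩)
    · refine Tendsto.mono_left ?_ nhdsWithin_le_nhds
      have : Continuous fun τ : ℝ => t - τ := by fun_prop
      simpa using this.tendsto t
    · filter_upwards [self_mem_nhdsWithin] with τ hτ
      exact sub_pos.2 (Set.mem_Iio.1 hτ)
  rw [intervalIntegral.integral_eq_sub_of_hasDerivAt_of_tendsto ht hderiv hint hlim0 hlimt]
  have hexp : Complex.exp (-(z : ℂ) / t) * Complex.exp (-conj (w : ℂ) / t) =
      Complex.exp (-(a * (t : ℂ)⁻¹)) := by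
    rw [← Complex.exp_add, ha]
    ring_nf
  rw [kernelPrimitive, rangeKernel, ← ha, sub_zero]
  push_cast
  rw [← hexp]
  field_simp
  ring

/-! ### The transform on the span of the atoms and its extension -/

/-- The transform as a linear map into the functions on the half plane. -/
def transformLinear (t : ℝ) : Lp ℂ 2 (sourceMeasure t) →ₗ[ℂ] (RightHalfPlane → ℂ) where
  toFun g z := inner ℂ (atom t z) g
  map_add' _ _ := funext fun _ => inner_add_right _ _ _
  map_smul' _ _ := funext fun _ => inner_smul_right _ _ _

theorem transformLinear_apply (t : ℝ) (g : Lp ℂ 2 (sourceMeasure t)) (z : RightHalfPlane) :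
    transformLinear t g z = inner ℂ (atom t z) g := rfl

theorem transformLinear_atom {t : ℝ} (ht : 0 < t) (w : RightHalfPlane) :
    transformLinear t (atom t w) = fun z : RightHalfPlane => rangeKernel t z w :=
  funext fun z => inner_atom_atom ht z w

/-- The inclusion of the range space into `L²(μᵗ)`. -/
def rangeToLp (t : ℝ) : rangeSpace t →ₗ[ℂ] Lp ℂ 2 (inversionMeasure t) where
  toFun F := (mem_rangeSpace_iff.1 F.2).2.toLp F
  map_add' _ _ := rfl
  map_smul' _ _ := rfl

theorem coeFn_rangeToLp {t : ℝ} (F : rangeSpace t) :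
    rangeToLp t F =ᵐ[inversionMeasure t] (F : RightHalfPlane → ℂ) :=
  (mem_rangeSpace_iff.1 F.2).2.coeFn_toLp

theorem rangeNorm_eq_norm {t : ℝ} (F : rangeSpace t) : rangeNorm t F = ‖rangeToLp t F‖ := by
  rw [rangeNorm_eq, ← Real.sqrt_sq (norm_nonneg (rangeToLp t F)),
    ← inner_self_eq_norm_sq (𝕜 := ℂ), L2.inner_def, ← integral_re (L2.integrable_inner _ _)]
  congr 1
  refine integral_congr_ae ?_
  filter_upwards [coeFn_rangeToLp F] with z hz
  rw [inner_self_eq_norm_sq, hz]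

theorem inner_rangeToLp_kernel {t : ℝ} (F : rangeSpace t) (w : RightHalfPlane) :
    inner ℂ (rangeToLp t ⟨_, rangeKernel_mem t w⟩) (rangeToLp t F) =
      (F : RightHalfPlane → ℂ) w := by
  rw [L2.inner_def, ← integral_mul_conj_rangeKernel F.2 w]
  refine integral_congr_ae ?_
  filter_upwards [coeFn_rangeToLp F, coeFn_rangeToLp ⟨_, rangeKernel_mem t w⟩] with z h1 h2
  rw [h1, h2, RCLike.inner_apply]

theorem transformLinear_mem_of_mem_span {t : ℝ} (ht : 0 < t) {g : Lp ℂ 2 (sourceMeasure t)}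
    (hg : g ∈ Submodule.span ℂ (Set.range (atom t))) : transformLinear t g ∈ rangeSpace t := by
  have h : Submodule.span ℂ (Set.range (atom t)) ≤ (rangeSpace t).comap (transformLinear t) := by
    rw [Submodule.span_le]
    rintro _ ⟨w, rfl⟩
    change transformLinear t (atom t w) ∈ rangeSpace t
    rw [transformLinear_atom ht]
    exact rangeKernel_mem t w
  exact h hg

theorem inner_rangeToLp_transformLinear_atom {t : ℝ} (ht : 0 < t) (F : rangeSpace t)
    (w : RightHalfPlane) (h : transformLinear t (atom t w) ∈ rangeSpace t) :
    inner ℂ (rangeToLp t ⟨_, h⟩) (rangeToLp t F) = (F : RightHalfPlane → ℂ) w := by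
  rw [← inner_rangeToLp_kernel F w]
  congr 2
  exact Subtype.ext (transformLinear_atom ht w)

/-- For g' an atom at w, its transform is the reproducing kernel at w, so the left side is the
transform of g at w, which is the inner product with that atom. Linearity covers the span. -/
theorem inner_rangeToLp_transformLinear {t : ℝ} (ht : 0 < t) {g : Lp ℂ 2 (sourceMeasure t)}
    (hg : transformLinear t g ∈ rangeSpace t) {g' : Lp ℂ 2 (sourceMeasure t)}
    (hg' : g' ∈ Submodule.span ℂ (Set.range (atom t))) :
    inner ℂ (rangeToLp t ⟨_, transformLinear_mem_of_mem_span ht hg'⟩) (rangeToLp t ⟨_, hg⟩) =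
      inner ℂ g' g := by
  induction hg' using Submodule.span_induction with
  | mem x hx =>
    obtain ⟨w, rfl⟩ := hx
    exact inner_rangeToLp_transformLinear_atom ht ⟨_, hg⟩ w _
  | zero =>
    have : (⟨_, transformLinear_mem_of_mem_span ht (Submodule.zero_mem _)⟩ : rangeSpace t) = 0 :=
      Subtype.ext (map_zero (transformLinear t))
    rw [this, map_zero, inner_zero_left, inner_zero_left]
  | add x y hx hy h1 h2 =>
    have : (⟨_, transformLinear_mem_of_mem_span ht (Submodule.add_mem _ hx hy)⟩ : rangeSpace t) =
        ⟨_, transformLinear_mem_of_mem_span ht hx⟩ +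
          ⟨_, transformLinear_mem_of_mem_span ht hy⟩ :=
      Subtype.ext (map_add (transformLinear t) x y)
    rw [this, map_add, inner_add_left, inner_add_left, h1, h2]
  | smul c x hx h1 =>
    have : (⟨_, transformLinear_mem_of_mem_span ht (Submodule.smul_mem _ c hx)⟩ : rangeSpace t) =
        c • ⟨_, transformLinear_mem_of_mem_span ht hx⟩ :=
      Subtype.ext (map_smul (transformLinear t) c x)
    rw [this, map_smul, inner_smul_left, inner_smul_left, h1]

theorem norm_rangeToLp_transformLinear {t : ℝ} (ht : 0 < t) {g : Lp ℂ 2 (sourceMeasure t)}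
    (hg : g ∈ Submodule.span ℂ (Set.range (atom t))) :
    ‖rangeToLp t ⟨_, transformLinear_mem_of_mem_span ht hg⟩‖ = ‖g‖ := by
  have h := inner_rangeToLp_transformLinear ht (transformLinear_mem_of_mem_span ht hg) hg
  rw [inner_self_eq_norm_sq_to_K, inner_self_eq_norm_sq_to_K] at h
  have h2 : ‖rangeToLp t ⟨_, transformLinear_mem_of_mem_span ht hg⟩‖ ^ 2 = ‖g‖ ^ 2 := by
    exact_mod_cast h
  exact (sq_eq_sq₀ (norm_nonneg _) (norm_nonneg _)).1 h2

theorem exists_norm_atom_le {t : ℝ} {K : Set ℂ} (hK : IsCompact K)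
    (hKU : K ⊆ {z : ℂ | 0 < z.re}) :
    ∃ C : ℝ, ∀ z : RightHalfPlane, (z : ℂ) ∈ K → ‖atom t z‖ ≤ C := by
  have hc : ContinuousOn (fun z : ℂ => ‖z‖ * (2 / z.re ^ 2)) K := by
    refine ContinuousOn.mul (by fun_prop) (ContinuousOn.div (by fun_prop) (by fun_prop) ?_)
    intro z hz
    exact pow_ne_zero 2 (hKU hz).ne'
  obtain ⟨C, hC⟩ := hK.exists_bound_of_continuousOn hc
  refine ⟨measureUnivNNReal (sourceMeasure t) ^ (2 : ℝ≥0∞).toReal⁻¹ * max C 0, fun z hz => ?_⟩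
  refine Lp.norm_le_of_ae_bound (le_max_right _ _) ?_
  filter_upwards [(memLp_conj_laplaceKernel t z).coeFn_toLp, ae_sourceMeasure_mem t] with τ h1 h2
  rw [atom, h1, RCLike.norm_conj]
  exact (norm_laplaceKernel_le z.2 le_rfl h2.2).trans
    ((le_abs_self _).trans ((hC z hz).trans (le_max_left _ _)))

/-- Atoms are bounded in norm over compact sets, so norm convergence of the arguments makes the
transforms converge locally uniformly. -/
theorem isHolomorphic_transformLinear_of_tendsto {t : ℝ} {g : Lp ℂ 2 (sourceMeasure t)}
    {u : ℕ → Lp ℂ 2 (sourceMeasure t)} (hu : ∀ n, IsHolomorphic (transformLinear t (u n)))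
    (hlim : Tendsto u atTop (𝓝 g)) : IsHolomorphic (transformLinear t g) := by
  classical
  choose G hG hGu using hu
  set H : ℂ → ℂ := fun z => if h : 0 < z.re then transformLinear t g ⟨z, h⟩ else 0 with hH
  refine ⟨H, ?_, fun z => by simp only [hH, dif_pos z.2]⟩
  refine TendstoLocallyUniformlyOn.differentiableOn (F := G) (φ := atTop) ?_
    (Eventually.of_forall hG) isOpen_halfPlane
  rw [tendstoLocallyUniformlyOn_iff_forall_isCompact isOpen_halfPlane]
  intro K hKU hK
  obtain ⟨C, hC⟩ := exists_norm_atom_le (t := t) hK hKU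
  rw [Metric.tendstoUniformlyOn_iff]
  intro ε hε
  have h1 : Tendsto (fun n => C * ‖g - u n‖) atTop (𝓝 0) := by
    have := (tendsto_const_nhds (x := g)).sub hlim
    rw [sub_self] at this
    simpa using this.norm.const_mul C
  filter_upwards [h1.eventually_lt_const hε] with n hn z hz
  have h2 : H z = transformLinear t g ⟨z, hKU hz⟩ := dif_pos (hKU hz)
  rw [h2, ← hGu n ⟨z, hKU hz⟩, dist_eq_norm, transformLinear_apply, transformLinear_apply,
    ← inner_sub_right]
  calc _ ≤ ‖atom t ⟨z, hKU hz⟩‖ * ‖g - u n‖ := norm_inner_le_norm _ _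
    _ ≤ C * ‖g - u n‖ := by
      gcongr
      exact hC _ hz
    _ < ε := hn

/-- Approximation from the span converges pointwise, and Fatou's lemma bounds the norm of the limit.
The inequality suffices here; equality comes later from the adjoint. -/
theorem transformLinear_mem_and_eLpNorm_le {t : ℝ} (ht : 0 < t) (g : Lp ℂ 2 (sourceMeasure t)) :
    transformLinear t g ∈ rangeSpace t ∧
      eLpNorm (transformLinear t g) 2 (inversionMeasure t) ≤ ENNReal.ofReal ‖g‖ := by
  obtain ⟨u, hu, hlim⟩ := mem_closure_iff_seq_limit.1 (dense_span_atom t g)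
  have hmem := fun n => mem_rangeSpace_iff.1 (transformLinear_mem_of_mem_span ht (hu n))
  have hhol := isHolomorphic_transformLinear_of_tendsto (fun n => (hmem n).1) hlim
  have hnorm : ∀ n, eLpNorm (transformLinear t (u n)) 2 (inversionMeasure t) =
      ENNReal.ofReal ‖u n‖ := by
    intro n
    rw [← norm_rangeToLp_transformLinear ht (hu n)]
    change _ = ENNReal.ofReal ‖(hmem n).2.toLp _‖
    rw [Lp.norm_toLp, ENNReal.ofReal_toReal (hmem n).2.2.ne]
  have hle : eLpNorm (transformLinear t g) 2 (inversionMeasure t) ≤ ENNReal.ofReal ‖g‖ := by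
    refine (Lp.eLpNorm_lim_le_liminf_eLpNorm (fun n => (hmem n).2.1) _
      (ae_of_all _ fun z => ?_)).trans ?_
    · exact ((innerSL ℂ (atom t z)).continuous.tendsto g).comp hlim
    · simp_rw [hnorm]
      exact (((ENNReal.continuous_ofReal.comp continuous_norm).tendsto g).comp
        hlim).liminf_eq.le
  exact ⟨mem_rangeSpace_iff.2 ⟨hhol, hhol.continuous.aestronglyMeasurable,
    hle.trans_lt ENNReal.ofReal_lt_top⟩, hle⟩

/-! ### Isometry, surjectivity and the adjoint as inverse -/

/-- The transform as a linear map into the range space. -/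
def transformRange {t : ℝ} (ht : 0 < t) : Lp ℂ 2 (sourceMeasure t) →ₗ[ℂ] rangeSpace t :=
  (transformLinear t).codRestrict _ fun g => (transformLinear_mem_and_eLpNorm_le ht g).1

theorem transformRange_apply {t : ℝ} (ht : 0 < t) (g : Lp ℂ 2 (sourceMeasure t))
    (z : RightHalfPlane) :
    (transformRange ht g : RightHalfPlane → ℂ) z = inner ℂ (atom t z) g := rfl

/-- The transform as a continuous linear map into `L²(μᵗ)`. -/
def transformLp {t : ℝ} (ht : 0 < t) :
    Lp ℂ 2 (sourceMeasure t) →L[ℂ] Lp ℂ 2 (inversionMeasure t) :=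
  (rangeToLp t ∘ₗ transformRange ht).mkContinuous 1 fun g => by
    rw [one_mul]
    change ‖(mem_rangeSpace_iff.1 (transformRange ht g).2).2.toLp _‖ ≤ _
    rw [Lp.norm_toLp]
    exact ENNReal.toReal_le_of_le_ofReal (norm_nonneg _)
      (transformLinear_mem_and_eLpNorm_le ht g).2

theorem transformLp_apply {t : ℝ} (ht : 0 < t) (g : Lp ℂ 2 (sourceMeasure t)) :
    transformLp ht g = rangeToLp t (transformRange ht g) := rfl

theorem inner_transformLp_atom {t : ℝ} (ht : 0 < t) (w : RightHalfPlane) (F : rangeSpace t) :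
    inner ℂ (transformLp ht (atom t w)) (rangeToLp t F) = (F : RightHalfPlane → ℂ) w :=
  inner_rangeToLp_transformLinear_atom ht F w _

open ContinuousLinearMap in
-- By density it is enough to test on atoms: ⟨Tv, T atom_w⟩ is the conjugate of (Tv)(w), that is ⟨v,
-- atom_w⟩.
theorem adjoint_comp_transformLp {t : ℝ} (ht : 0 < t) :
    adjoint (transformLp ht) ∘L transformLp ht = 1 := by
  refine ContinuousLinearMap.ext_on (dense_span_atom t) ?_
  rintro _ ⟨w, rfl⟩
  refine ext_inner_left ℂ fun v => ?_
  rw [ContinuousLinearMap.comp_apply, adjoint_inner_right, ← inner_conj_symm,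
    transformLp_apply ht v, inner_transformLp_atom, transformRange_apply, inner_conj_symm]
  rfl

theorem norm_transformLp {t : ℝ} (ht : 0 < t) (g : Lp ℂ 2 (sourceMeasure t)) :
    ‖transformLp ht g‖ = ‖g‖ :=
  (ContinuousLinearMap.norm_map_iff_adjoint_comp_self _).2 (adjoint_comp_transformLp ht) g

open ContinuousLinearMap in
-- The value at w is ⟨atom_w, T*F⟩ = ⟨T atom_w, F⟩ = F(w) by the reproducing property. This gives
-- surjectivity and the inverse at once.
theorem transformRange_adjoint {t : ℝ} (ht : 0 < t) (F : rangeSpace t) :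
    transformRange ht (adjoint (transformLp ht) (rangeToLp t F)) = F := by
  refine Subtype.ext (funext fun w => ?_)
  rw [transformRange_apply, adjoint_inner_right, inner_transformLp_atom]

/-- The transform as a linear equivalence onto the range space. -/
def transformEquiv {t : ℝ} (ht : 0 < t) : Lp ℂ 2 (sourceMeasure t) ≃ₗ[ℂ] rangeSpace t :=
  LinearEquiv.ofBijective (transformRange ht)
    ⟨(injective_iff_map_eq_zero _).2 fun g hg => by
      rw [← norm_eq_zero, ← norm_transformLp ht, transformLp_apply, hg, map_zero, norm_zero],
    fun F => ⟨_, transformRange_adjoint ht F⟩⟩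

theorem transformEquiv_symm_apply {t : ℝ} (ht : 0 < t) (F : rangeSpace t) :
    (transformEquiv ht).symm F =
      ContinuousLinearMap.adjoint (transformLp ht) (rangeToLp t F) :=
  (LinearEquiv.symm_apply_eq _).2 (transformRange_adjoint ht F).symm

/-! ### Inversion along a compact exhaustion -/

theorem tendsto_toLp_indicator_compactExhaustion {X E : Type*} [TopologicalSpace X] [T2Space X]
    [MeasurableSpace X] [BorelSpace X] [NormedAddCommGroup E] {μ : Measure X} {f : X → E}
    (hf : MemLp f 2 μ) (K : CompactExhaustion X) :
    Tendsto (fun n => (hf.indicator (K.isCompact n).measurableSet).toLp ((K n).indicator f))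
      atTop (𝓝 (hf.toLp f)) := by
  rw [Lp.tendsto_Lp_iff_tendsto_eLpNorm'']
  simp_rw [eLpNorm_eq_lintegral_rpow_enorm_toReal two_ne_zero ENNReal.ofNat_ne_top]
  have h0 : (0 : ℝ≥0∞) = 0 ^ (1 / (2 : ℝ≥0∞).toReal) := by simp
  rw [h0]
  refine (ENNReal.continuous_rpow_const.tendsto 0).comp ?_
  have hfin : ∫⁻ x, ‖f x‖ₑ ^ (2 : ℝ≥0∞).toReal ∂μ ≠ ∞ :=
    (lintegral_rpow_enorm_lt_top_of_eLpNorm_lt_top two_ne_zero ENNReal.ofNat_ne_top hf.2).ne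
  rw [← lintegral_zero (μ := μ)]
  -- The squared difference is dominated by |f|², and at each x it vanishes once x lies in the
  -- exhausting set.
  refine tendsto_lintegral_of_dominated_convergence' _ (fun n => ?_) (fun n => ?_) hfin ?_
  · exact ((hf.indicator (K.isCompact n).measurableSet).1.sub hf.1).enorm.pow_const _
  · refine ae_of_all _ fun x => ENNReal.rpow_le_rpow ?_ ENNReal.toReal_nonneg
    by_cases hx : x ∈ K n
    · simp [hx]
    · simp [hx]
  · refine ae_of_all _ fun x => tendsto_const_nhds.congr' ?_
    filter_upwards [eventually_ge_atTop (K.find x)] with n hn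
    have hx : x ∈ K n := K.mem_iff_find_le.2 hn
    simp [hx]

theorem truncatedInverse_eq (t : ℝ) (F : RightHalfPlane → ℂ) (E : Set RightHalfPlane) (τ : ℝ) :
    truncatedInverse t F E τ = ∫ z in E, F z * conj (laplaceKernel t z τ) ∂inversionMeasure t := by
  rw [truncatedInverse, ← integral_const_mul]
  congr 1 with z
  simp only [inversionIntegrand, laplaceKernel, map_mul, map_div₀, map_pow, map_sub,
    Complex.conj_ofReal, ← Complex.exp_conj, map_neg]
  ring

theorem integrableOn_inversionMeasure_of_continuous (t : ℝ) {f : RightHalfPlane → ℂ}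
    (hf : Continuous f) {E : Set RightHalfPlane} (hE : IsCompact E) :
    IntegrableOn f E (inversionMeasure t) := by
  obtain ⟨C, hC⟩ := hE.exists_bound_of_continuousOn hf.continuousOn
  exact Measure.integrableOn_of_bounded (inversionMeasure_lt_top t hE).ne
    hf.aestronglyMeasurable ((ae_restrict_mem hE.measurableSet).mono hC)

theorem exists_norm_laplaceKernel_le (t : ℝ) {E : Set RightHalfPlane} (hE : IsCompact E) :
    ∃ C : ℝ, 0 ≤ C ∧ ∀ z ∈ E, ∀ τ ∈ Set.Ioo 0 t, ‖laplaceKernel t z τ‖ ≤ C := by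
  have hc : Continuous (fun z : RightHalfPlane => ‖(z : ℂ)‖ * (2 / (z : ℂ).re ^ 2)) :=
    Continuous.mul (by fun_prop) (Continuous.div (by fun_prop) (by fun_prop)
      fun z => pow_ne_zero 2 z.2.ne')
  obtain ⟨C, hC⟩ := hE.exists_bound_of_continuousOn hc.continuousOn
  exact ⟨max C 0, le_max_right _ _, fun z hz τ hτ => (norm_laplaceKernel_le z.2 le_rfl hτ.2).trans
    ((le_abs_self _).trans ((hC z hz).trans (le_max_left _ _)))⟩

theorem measurable_mul_conj_laplaceKernel (t : ℝ) {F : RightHalfPlane → ℂ} (hF : Continuous F) :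
    Measurable fun p : ℝ × RightHalfPlane => F p.2 * conj (laplaceKernel t p.2 p.1) := by
  have h1 : Measurable fun p : ℝ × RightHalfPlane => laplaceKernel t p.2 p.1 :=
    (measurable_laplaceKernel t).comp
      ((measurable_subtype_coe.comp measurable_snd).prodMk measurable_fst)
  exact (hF.measurable.comp measurable_snd).mul (Complex.continuous_conj.measurable.comp h1)

theorem memLp_truncatedInverse (t : ℝ) {F : RightHalfPlane → ℂ} (hF : Continuous F)
    {E : Set RightHalfPlane} (hE : IsCompact E) :
    MemLp (truncatedInverse t F E) 2 (sourceMeasure t) := by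
  have : Fact (inversionMeasure t E < ∞) := ⟨inversionMeasure_lt_top t hE⟩
  obtain ⟨C, hC0, hC⟩ := exists_norm_laplaceKernel_le t hE
  have hint := integrableOn_inversionMeasure_of_continuous t hF hE
  refine MemLp.of_bound ?_ (∫ z in E, ‖F z‖ * C ∂inversionMeasure t) ?_
  · have h := (measurable_mul_conj_laplaceKernel t hF).stronglyMeasurable.integral_prod_right'
      (ν := (inversionMeasure t).restrict E)
    have h2 : truncatedInverse t F E = fun τ =>
        ∫ z in E, F z * conj (laplaceKernel t z τ) ∂inversionMeasure t :=
      funext fun τ => truncatedInverse_eq t F E τ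
    rw [h2]
    exact h.aestronglyMeasurable
  · filter_upwards [ae_sourceMeasure_mem t] with τ hτ
    rw [truncatedInverse_eq]
    refine norm_integral_le_of_norm_le (hint.norm.mul_const C) ?_
    filter_upwards [ae_restrict_mem hE.measurableSet] with z hz
    rw [norm_mul, RCLike.norm_conj]
    gcongr
    exact hC z hz τ hτ

/-- This licenses Fubini: g is integrable because the source measure is finite, F is integrable on
E, and the kernel is bounded for z in E. -/
theorem integrable_prod_kernel {t : ℝ} (g : Lp ℂ 2 (sourceMeasure t)) {F : RightHalfPlane → ℂ}
    (hF : Continuous F) {E : Set RightHalfPlane} (hE : IsCompact E) :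
    Integrable (fun p : ℝ × RightHalfPlane =>
      conj (g p.1) * (F p.2 * conj (laplaceKernel t p.2 p.1)))
      ((sourceMeasure t).prod ((inversionMeasure t).restrict E)) := by
  have : Fact (inversionMeasure t E < ∞) := ⟨inversionMeasure_lt_top t hE⟩
  obtain ⟨C, hC0, hC⟩ := exists_norm_laplaceKernel_le t hE
  have hint : Integrable F ((inversionMeasure t).restrict E) :=
    integrableOn_inversionMeasure_of_continuous t hF hE
  have hg : Integrable (fun τ => conj (g τ)) (sourceMeasure t) :=
    (LinearIsometryEquiv.integrable_comp_iff Complex.conjLIE).2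
      ((Lp.memLp g).integrable one_le_two)
  refine ((hg.mul_prod hint).norm.mul_const C).mono' ?_ ?_
  · exact hg.aestronglyMeasurable.comp_fst.mul
      (measurable_mul_conj_laplaceKernel t hF).aestronglyMeasurable
  · have h1 : ∀ᵐ p ∂(sourceMeasure t).prod ((inversionMeasure t).restrict E),
        p.1 ∈ Set.Ioo 0 t := Measure.quasiMeasurePreserving_fst.ae (ae_sourceMeasure_mem t)
    have h2 : ∀ᵐ p ∂(sourceMeasure t).prod ((inversionMeasure t).restrict E), p.2 ∈ E :=
      Measure.quasiMeasurePreserving_snd.ae (ae_restrict_mem hE.measurableSet)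
    filter_upwards [h1, h2] with p hp1 hp2
    rw [← mul_assoc, norm_mul _ (conj _), RCLike.norm_conj]
    gcongr
    exact hC _ hp2 _ hp1

open ContinuousLinearMap in
-- Paired with any g, both sides are the same double integral over (0, t) × E, in the two orders of
-- integration.
theorem adjoint_transformLp_indicator {t : ℝ} (ht : 0 < t) (F : rangeSpace t)
    {E : Set RightHalfPlane} (hE : IsCompact E)
    (hm : MemLp (E.indicator (F : RightHalfPlane → ℂ)) 2 (inversionMeasure t))
    (hE2 : MemLp (truncatedInverse t F E) 2 (sourceMeasure t)) :
    adjoint (transformLp ht) (hm.toLp _) = hE2.toLp _ := by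
  have : Fact (inversionMeasure t E < ∞) := ⟨inversionMeasure_lt_top t hE⟩
  have hF : Continuous (F : RightHalfPlane → ℂ) := (mem_rangeSpace_iff.1 F.2).1.continuous
  refine ext_inner_left ℂ fun g => ?_
  rw [adjoint_inner_right, L2.inner_def, L2.inner_def]
  have hl : (fun z => inner ℂ (transformLp ht g z) (hm.toLp _ z)) =ᵐ[inversionMeasure t]
      E.indicator fun z => ∫ τ, conj (g τ) * ((F : RightHalfPlane → ℂ) z *
        conj (laplaceKernel t z τ)) ∂sourceMeasure t := by
    filter_upwards [hm.coeFn_toLp, coeFn_rangeToLp (transformRange ht g)] with z h1 h2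
    rw [transformLp_apply, h1, h2, transformRange_apply]
    by_cases hz : z ∈ E
    · rw [Set.indicator_of_mem hz, Set.indicator_of_mem hz, RCLike.inner_apply, inner_atom,
        ← integral_conj, ← integral_const_mul]
      congr 1 with τ
      rw [map_mul]
      ring
    · rw [Set.indicator_of_notMem hz, Set.indicator_of_notMem hz, inner_zero_right]
  have hr : (fun τ => inner ℂ (g τ) (hE2.toLp _ τ)) =ᵐ[sourceMeasure t]
      fun τ => ∫ z in E, conj (g τ) * ((F : RightHalfPlane → ℂ) z *
        conj (laplaceKernel t z τ)) ∂inversionMeasure t := by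
    filter_upwards [hE2.coeFn_toLp] with τ h1
    rw [h1, RCLike.inner_apply, truncatedInverse_eq, integral_const_mul, mul_comm]
  rw [integral_congr_ae hl, integral_congr_ae hr, integral_indicator hE.measurableSet]
  exact (integral_integral_swap (integrable_prod_kernel g hF hE)).symm

end

theorem mainTheorem4 (t : ℝ) (ht : 0 < t) :
    (∀ (g : Lp ℂ 2 (sourceMeasure t)) (z : RightHalfPlane),
      IntegrableOn (transformIntegrand t g z) (Set.Ioo 0 t) volume) ∧
    ∃ Φ : Lp ℂ 2 (sourceMeasure t) ≃ₗ[ℂ] rangeSpace t,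
      (∀ (g : Lp ℂ 2 (sourceMeasure t)) (z : RightHalfPlane),
        (Φ g : RightHalfPlane → ℂ) z = transform t g z) ∧
      (∀ g : Lp ℂ 2 (sourceMeasure t), rangeNorm t (Φ g) = ‖g‖) ∧
      ∀ (F : rangeSpace t) (E : CompactExhaustion RightHalfPlane),
        (∀ N : ℕ, ∀ τ ∈ Set.Ioo 0 t,
          IntegrableOn (inversionIntegrand t F τ) (E N) (inversionMeasure t)) ∧
        ∃ hE : ∀ N : ℕ, MemLp (truncatedInverse t F (E N)) 2 (sourceMeasure t),
          Tendsto (fun N : ℕ => (hE N).toLp (truncatedInverse t F (E N))) atTop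
            (𝓝 (Φ.symm F)) := by
  refine ⟨integrableOn_transformIntegrand ht, transformEquiv ht,
    fun g z => (transform_eq_inner ht g z).symm,
    fun g => (rangeNorm_eq_norm _).trans (norm_transformLp ht g), fun F E => ?_⟩
  have hF : Continuous (F : RightHalfPlane → ℂ) := (mem_rangeSpace_iff.1 F.2).1.continuous
  refine ⟨fun N τ _ => integrableOn_inversionMeasure_of_continuous t ?_ (E.isCompact N),
    fun N => memLp_truncatedInverse t hF (E.isCompact N), ?_⟩
  · unfold inversionIntegrand
    fun_prop
  · rw [transformEquiv_symm_apply]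
    -- The truncations of F leave the range space but converge in L²(μᵗ), where the adjoint is
    -- defined and continuous.
    refine (((ContinuousLinearMap.adjoint (transformLp ht)).continuous.tendsto _).comp
      (tendsto_toLp_indicator_compactExhaustion (mem_rangeSpace_iff.1 F.2).2 E)).congr fun N => ?_
    exact adjoint_transformLp_indicator ht F (E.isCompact N) _ _
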